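/- Let $G=(V,E)$ be a finite simple undirected graph with $n=|V|$ vertices, let $t\ge 0$ be an integer, and for $S\subseteq V$ let $G[S]$ denote the subgraph induced by $S$. The set $S$ is a \emph{2-club} if $G[S]$ has diameter at most two, that is, any two vertices of $S$ have distance at most two in $G[S]$. Moreover, $S$ is \begin{itemize} \item a \emph{$t$-robust 2-club} if any two distinct vertices of $S$ are connected in $G[S]$ by $t$ distinct, pairwise internally vertex-disjoint paths of length at most two; \item a \emph{$t$-hereditary 2-club} if $G[S\setminus U]$ is a 2-club for all $U\subseteq S$ with $|U|\le t$; \item a \emph{$t$-connected 2-club} if $S$ is a 2-club, $|S|>t$, and $G[S\setminus U]$ is connected for all $U\subseteq S$ with $|U|<t$. \end{itemize} The problems \textsc{$t$-Robust 2-Club}, \textsc{$t$-Hereditary 2-Club} and \textsc{$t$-Connected 2-Club} have as input a graph $G$ and nonnegative integers $t$ and $k$, and ask whether $G$ contains a $t$-robust, $t$-hereditary or $t$-connected 2-club, respectively, of size at least $k$. Each of the three problems can be solved in $O(1.62^n)$ time, where the bound is uniform in $t$ and $k$. Here time is the number of steps of a random access machine with unit-cost operations whose machine words hold $O(\log n)$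 bits in addition to the numbers $t$ and $k$, and $G$ is given by its adjacency matrix. -/

import Mathlib

/-! ## The three models of well-connected 2-clubs -/

namespace TwoClub

variable {V : Type*}

/-- `S` is a 2-club in `G`: the induced subgraph `G[S]` has diameter at most two (`ediam` is the
supremum of all distances, and the distance between disconnected vertices is `⊤`). -/
def IsTwoClub (G : SimpleGraph V) (S : Set V) : Prop :=
  (G.induce S).ediam ≤ 2

/-- Two `u`-`v` paths are internally vertex-disjoint: they share no vertex except `u` and `v`. -/
def InternallyDisjoint {G : SimpleGraph V} {u v : V} (p q : G.Path u v) : Prop :=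
  ∀ x, x ∈ p.1.support → x ∈ q.1.support → x = u ∨ x = v

/-- `S` is a `t`-robust 2-club in `G`: any two distinct vertices of `S` are connected in `G[S]` by
`t` (distinct) internally vertex-disjoint paths of length at most two. -/
def IsRobust (t : ℕ) (G : SimpleGraph V) (S : Finset V) : Prop :=
  ∀ u v : (S : Set V), u ≠ v →
    ∃ P : Finset ((G.induce (S : Set V)).Path u v),
      P.card = t ∧ (∀ p ∈ P, p.1.length ≤ 2) ∧
        (P : Set ((G.induce (S : Set V)).Path u v)).Pairwise InternallyDisjoint

/-- `S` is a `t`-hereditary 2-club in `G`: `G[S \ U]` is a 2-club for all `U ⊆ S` with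
`|U| ≤ t`. -/
def IsHereditary (t : ℕ) (G : SimpleGraph V) (S : Finset V) : Prop :=
  ∀ U : Finset V, U ⊆ S → U.card ≤ t → IsTwoClub G ((S : Set V) \ (U : Set V))

/-- `S` is a `t`-connected 2-club in `G`: it is a 2-club, `|S| > t`, and `G[S \ U]` is connected
for all `U ⊆ S` with `|U| < t`. -/
def IsConnected (t : ℕ) (G : SimpleGraph V) (S : Finset V) : Prop :=
  IsTwoClub G (S : Set V) ∧ t < S.card ∧
    ∀ U : Finset V, U ⊆ S → U.card < t →
      (G.induce ((S : Set V) \ (U : Set V))).Connected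

/-- A decision problem whose instances consist of a graph on `n` vertices and two nonnegative
integers `t` and `k`. -/
abbrev Problem : Type := (n : ℕ) → SimpleGraph (Fin n) → (t k : ℕ) → Prop

/-- Does `G` contain a `t`-robust 2-club of size at least `k`? -/
def RobustTwoClub : Problem := fun n G t k =>
  ∃ S : Finset (Fin n), IsRobust t G S ∧ k ≤ S.card

/-- Does `G` contain a `t`-hereditary 2-club of size at least `k`? -/
def HereditaryTwoClub : Problem := fun n G t k =>
  ∃ S : Finset (Fin n), IsHereditary t G S ∧ k ≤ S.card

/-- Does `G` contain a `t`-connected 2-club of size at least `k`? -/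
def ConnectedTwoClub : Problem := fun n G t k =>
  ∃ S : Finset (Fin n), IsConnected t G S ∧ k ≤ S.card

end TwoClub

/-! ## Random access machines with bounded word length

The memory consists of registers and arrays, all of whose cells hold natural numbers. Registers
and arrays are named by numerals that are fixed in the program, so that a program uses only
finitely many of them; array cells are addressed indirectly. Every operation takes unit time, and
every number that occurs in a computation, an array index included, has to fit into a machine
word, that is, must not exceed a bound `B`; a computation in which this fails does not count. -/

namespace WordRAM

/-- The contents of the memory: `reg i` is the value of register `i`, and `arr a j` is the value of
cell `j` of array `a`. -/
structure Store where
  reg : ℕ → ℕ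
  arr : ℕ → ℕ → ℕ

/-- The binary operations of the machine. -/
inductive Op where
  | add
  | sub
  | mul
  | lt
  | eq

/-- Subtraction is truncated at zero, and comparisons return `1` (true) or `0` (false). -/
def Op.apply : Op → ℕ → ℕ → ℕ
  | .add, x, y => x + y
  | .sub, x, y => x - y
  | .mul, x, y => x * y
  | .lt, x, y => if x < y then 1 else 0
  | .eq, x, y => if x = y then 1 else 0

/-- Expressions: constants, registers, array cells with a computed index, binary operations. -/
inductive Expr where
  | const (c : ℕ)
  | reg (i : ℕ)
  | cell (a : ℕ) (index : Expr)
  | op (o : Op) (e₁ e₂ : Expr)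

/-- The value of an expression. -/
def Expr.eval (s : Store) : Expr → ℕ
  | .const c => c
  | .reg i => s.reg i
  | .cell a e => s.arr a (e.eval s)
  | .op o e₁ e₂ => o.apply (e₁.eval s) (e₂.eval s)

/-- The time for the evaluation of an expression: one step for each of its nodes. -/
def Expr.cost : Expr → ℕ
  | .const _ => 1
  | .reg _ => 1
  | .cell _ e => e.cost + 1
  | .op _ e₁ e₂ => e₁.cost + e₂.cost + 1

/-- All numbers that occur in the evaluation of the expression are at most `B`. -/
def Expr.Fits (B : ℕ) (s : Store) : Expr → Prop
  | .const c => c ≤ B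
  | .reg i => s.reg i ≤ B
  | .cell a e => e.Fits B s ∧ s.arr a (e.eval s) ≤ B
  | .op o e₁ e₂ => e₁.Fits B s ∧ e₂.Fits B s ∧ o.apply (e₁.eval s) (e₂.eval s) ≤ B

/-- Programs. In tests, a nonzero value means true. -/
inductive Prog where
  | skip
  /-- put the value of `e` into register `i` -/
  | set (i : ℕ) (e : Expr)
  /-- put the value of `e` into the cell of array `a` with the given index -/
  | store (a : ℕ) (index e : Expr)
  | seq (p q : Prog)
  /-- run `p` if the value of `e` is nonzero, and `q` otherwise -/
  | cond (e : Expr) (p q : Prog)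
  /-- run `p` repeatedly, as long as the value of `e` is nonzero -/
  | loop (e : Expr) (p : Prog)

/-- `Exec B p s τ s'`: started with memory `s`, the program `p` halts after exactly `τ` steps with
memory `s'`, and no number exceeds `B` during the computation. -/
inductive Exec (B : ℕ) : Prog → Store → ℕ → Store → Prop
  | skip (s : Store) : Exec B .skip s 1 s
  | set (s : Store) (i : ℕ) (e : Expr) (he : e.Fits B s) :
      Exec B (.set i e) s (e.cost + 1) { s with reg := Function.update s.reg i (e.eval s) }
  | store (s : Store) (a : ℕ) (d e : Expr) (hd : d.Fits B s) (he : e.Fits B s) :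
      Exec B (.store a d e) s (d.cost + e.cost + 1)
        { s with
          arr := Function.update s.arr a (Function.update (s.arr a) (d.eval s) (e.eval s)) }
  | seq {p q : Prog} {s s' s'' : Store} {τ τ' : ℕ}
      (hp : Exec B p s τ s') (hq : Exec B q s' τ' s'') :
      Exec B (.seq p q) s (τ + τ') s''
  | cond_true {e : Expr} {p q : Prog} {s s' : Store} {τ : ℕ}
      (he : e.Fits B s) (hne : e.eval s ≠ 0) (hp : Exec B p s τ s') :
      Exec B (.cond e p q) s (e.cost + 1 + τ) s'
  | cond_false {e : Expr} {p q : Prog} {s s' : Store} {τ : ℕ}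
      (he : e.Fits B s) (heq : e.eval s = 0) (hq : Exec B q s τ s') :
      Exec B (.cond e p q) s (e.cost + 1 + τ) s'
  | loop_true {e : Expr} {p : Prog} {s s' s'' : Store} {τ τ' : ℕ}
      (he : e.Fits B s) (hne : e.eval s ≠ 0) (hp : Exec B p s τ s')
      (hl : Exec B (.loop e p) s' τ' s'') :
      Exec B (.loop e p) s (e.cost + 1 + τ + τ') s''
  | loop_false {e : Expr} {p : Prog} {s : Store}
      (he : e.Fits B s) (heq : e.eval s = 0) :
      Exec B (.loop e p) s (e.cost + 1) s

open Classical in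
/-- The memory at the start: registers `0`, `1`, `2` hold `n`, `t`, `k`, array `0` holds the
adjacency matrix of the graph row by row, and all other cells hold `0`. -/
noncomputable def input (n : ℕ) (G : SimpleGraph (Fin n)) (t k : ℕ) : Store where
  reg i := if i = 0 then n else if i = 1 then t else if i = 2 then k else 0
  arr a m :=
    if a = 0 ∧ ∃ i j : Fin n, m = (i : ℕ) * n + (j : ℕ) ∧ G.Adj i j then 1 else 0

open Classical in
/-- The program `p` decides the problem `Q`, and on every instance with `n` vertices it takes at
most `T n` steps, whatever the numbers `t` and `k` are. Its answer, `1` (yes) or `0` (no), is left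
in register `0`. The numbers `t` and `k` fit into a machine word, and apart from that the word
length is `O(log n)`: for some constant `c`, numbers up to `(n + 2) ^ c + t + k` are allowed. -/
def DecidesInTime (p : Prog) (Q : TwoClub.Problem) (T : ℕ → ℕ) : Prop :=
  ∃ c : ℕ, ∀ (n : ℕ) (G : SimpleGraph (Fin n)) (t k : ℕ),
    ∃ (τ : ℕ) (s : Store), Exec ((n + 2) ^ c + t + k) p (input n G t k) τ s ∧
      τ ≤ T n ∧ s.reg 0 = if Q n G t k then 1 else 0

/-- The problem `Q` can be solved in `O(g(n))` time, where `n` is the number of vertices. -/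
def SolvableInTimeO (Q : TwoClub.Problem) (g : ℕ → ℝ) : Prop :=
  ∃ (p : Prog) (T : ℕ → ℕ), DecidesInTime p Q T ∧
    (fun n => (T n : ℝ)) =O[Filter.atTop] g

end WordRAM

/-! ## A program logic for the random access machine -/

namespace WordRAM

/-! Each of the three properties of `S` amounts to the absence of bad pairs, that is, of distinct
`u, v ∈ S` whose connection inside `S` is too weak; for connected 2-clubs the size condition `t <
|S|` is added (`isRobust_iff`, `isHereditary_iff`, `isConnected_iff`). A bad pair stays bad when `S`
shrinks to a subset that still contains it. Hence, if `u, v` is bad in the set of all vertices not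
yet deleted, no solution inside this set contains both, and one may branch: delete `u`, or keep `u`
and delete `v`. If one of them has already been kept, the other must be deleted; if both have been
kept, the branch is dead. If there is no bad pair, the whole set is the largest candidate of its
branch, and its size decides.

From `m` undecided vertices the two children have `m - 1` and `m - 2`, so the search tree grows like
the Fibonacci numbers, at a rate below 1.619 (`treeSize_le`). The work per node is polynomial in
`n`, uniformly in `t` and `k`, which only enter comparisons; the gap between 1.619 and 1.62 absorbs
it (`treeSize_mul_time_isBigO`).

For robust and hereditary 2-clubs, badness is a matter of adjacency and of the number of common
neighbors. For connected 2-clubs it requires a minimum vertex cut between nonadjacent vertices,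
found by augmenting paths in a network with split vertices. The argument speaks of cuts only and not
of flows: reversing a path lowers every cut between source and sink by exactly one
(`PathReversal.finish`), and once the sink is out of reach, the reachable nodes form a residual cut
of capacity zero (`Augmentation.stuck`). So the number of augmentations is the minimum cut
(`flow_lt_iff`).

On the machine, the open nodes form a stack of status vectors. `WP` tracks termination, time and
word size at once. Counting loops make at most `2 * n` passes each, so their programs take
polynomial time (`Prog.time_le_pow`); the passes of the main loop are bounded by the total tree size
of the open nodes (`expand_spec`, `solver_decides`). -/

/-- All numbers in the memory are at most `B`. -/
def Store.Bdd (B : ℕ) (s : Store) : Prop :=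
  (∀ i, s.reg i ≤ B) ∧ ∀ a j, s.arr a j ≤ B

/-- The memory after putting `x` into register `i`. -/
def Store.setReg (s : Store) (i x : ℕ) : Store :=
  { s with reg := Function.update s.reg i x }

/-- The memory after putting `x` into cell `j` of array `a`. -/
def Store.setCell (s : Store) (a j x : ℕ) : Store :=
  { s with arr := Function.update s.arr a (Function.update (s.arr a) j x) }

@[simp] theorem Store.setReg_reg (s : Store) (i x k : ℕ) :
    (s.setReg i x).reg k = if k = i then x else s.reg k := by
  simp [Store.setReg, Function.update_apply]

@[simp] theorem Store.setReg_arr (s : Store) (i x : ℕ) : (s.setReg i x).arr = s.arr := rfl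

@[simp] theorem Store.setCell_reg (s : Store) (a j x : ℕ) : (s.setCell a j x).reg = s.reg := rfl

@[simp] theorem Store.setCell_arr (s : Store) (a j x b m : ℕ) :
    (s.setCell a j x).arr b m = if b = a ∧ m = j then x else s.arr b m := by
  by_cases h : b = a
  · subst h; simp [Store.setCell, Function.update_apply]
  · simp [Store.setCell, h]

theorem Store.Bdd.setReg {B : ℕ} {s : Store} (h : s.Bdd B) {x : ℕ} (hx : x ≤ B) (i : ℕ) :
    (s.setReg i x).Bdd B := by
  refine ⟨fun k => ?_, h.2⟩
  rw [Store.setReg_reg]; split_ifs; exacts [hx, h.1 k]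

theorem Store.Bdd.setCell {B : ℕ} {s : Store} (h : s.Bdd B) {x : ℕ} (hx : x ≤ B) (a j : ℕ) :
    (s.setCell a j x).Bdd B := by
  refine ⟨h.1, fun b m => ?_⟩
  rw [Store.setCell_arr]; split_ifs; exacts [hx, h.2 b m]

/-- In a memory bounded by `B`, the sums and products occurring in the expression are at
most `B`. -/
def Expr.Small (B : ℕ) (s : Store) : Expr → Prop
  | .const c => c ≤ B
  | .reg _ => True
  | .cell _ e => e.Small B s
  | .op .add e₁ e₂ => e₁.Small B s ∧ e₂.Small B s ∧ e₁.eval s + e₂.eval s ≤ B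
  | .op .mul e₁ e₂ => e₁.Small B s ∧ e₂.Small B s ∧ e₁.eval s * e₂.eval s ≤ B
  | .op _ e₁ e₂ => e₁.Small B s ∧ e₂.Small B s

theorem Expr.Fits.eval_le {B : ℕ} {s : Store} : ∀ {e : Expr}, e.Fits B s → e.eval s ≤ B
  | .const _, h => h
  | .reg _, h => h
  | .cell _ _, h => h.2
  | .op _ _ _, h => h.2.2

/-- Only constants, sums and products need attention: registers and cells are bounded by assumption,
truncated subtraction does not exceed its first operand, and comparisons return at most `1`. -/
theorem Expr.Small.fits {B : ℕ} {s : Store} (hB : 1 ≤ B) (hs : s.Bdd B) :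
    ∀ {e : Expr}, e.Small B s → e.Fits B s
  | .const _, h => h
  | .reg i, _ => hs.1 i
  | .cell a e, h => ⟨Expr.Small.fits hB hs (e := e) h, hs.2 a _⟩
  | .op .add _ _, h => ⟨h.1.fits hB hs, h.2.1.fits hB hs, h.2.2⟩
  | .op .mul _ _, h => ⟨h.1.fits hB hs, h.2.1.fits hB hs, h.2.2⟩
  | .op .sub _ _, h =>
      ⟨h.1.fits hB hs, h.2.fits hB hs, (Nat.sub_le _ _).trans (h.1.fits hB hs).eval_le⟩
  | .op .lt _ _, h => ⟨h.1.fits hB hs, h.2.fits hB hs, by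
      simp only [Op.apply]; split_ifs <;> omega⟩
  | .op .eq _ _, h => ⟨h.1.fits hB hs, h.2.fits hB hs, by
      simp only [Op.apply]; split_ifs <;> omega⟩

/-- A bound for the running time of programs whose loops make at most `N` passes each. -/
def Prog.time (N : ℕ) : Prog → ℕ
  | .skip => 1
  | .set _ e => e.cost + 1
  | .store _ d e => d.cost + e.cost + 1
  | .seq p q => p.time N + q.time N
  | .cond e p q => e.cost + 1 + (p.time N + q.time N)
  | .loop e p => N * (e.cost + 1 + p.time N) + (e.cost + 1)

/-- For a fixed program the time is polynomial in the bound on the passes, since each level of loop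
nesting raises the degree by one. The exponent for a composition is the sum rather than the maximum,
which is cruder but simpler. -/
theorem Prog.time_le_pow (p : Prog) : ∃ C d : ℕ, ∀ N, p.time N ≤ C * (N + 1) ^ d := by
  induction p with
  | skip => exact ⟨1, 0, fun N => by simp [Prog.time]⟩
  | set i e => exact ⟨e.cost + 1, 0, fun N => by simp [Prog.time]⟩
  | store a d e => exact ⟨d.cost + e.cost + 1, 0, fun N => by simp [Prog.time]⟩
  | seq p q hp hq =>
    obtain ⟨C, d, h⟩ := hp
    obtain ⟨C', d', h'⟩ := hq
    refine ⟨C + C', d + d', fun N => ?_⟩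
    have h₁ : (N + 1) ^ d ≤ (N + 1) ^ (d + d') := Nat.pow_le_pow_right (by omega) (by omega)
    have h₂ : (N + 1) ^ d' ≤ (N + 1) ^ (d + d') := Nat.pow_le_pow_right (by omega) (by omega)
    calc p.time N + q.time N ≤ C * (N + 1) ^ d + C' * (N + 1) ^ d' := add_le_add (h N) (h' N)
      _ ≤ C * (N + 1) ^ (d + d') + C' * (N + 1) ^ (d + d') := by gcongr
      _ = _ := by ring
  | cond e p q hp hq =>
    obtain ⟨C, d, h⟩ := hp
    obtain ⟨C', d', h'⟩ := hq
    refine ⟨e.cost + 1 + C + C', d + d', fun N => ?_⟩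
    have h₁ : (N + 1) ^ d ≤ (N + 1) ^ (d + d') := Nat.pow_le_pow_right (by omega) (by omega)
    have h₂ : (N + 1) ^ d' ≤ (N + 1) ^ (d + d') := Nat.pow_le_pow_right (by omega) (by omega)
    have h₃ : 1 ≤ (N + 1) ^ (d + d') := Nat.one_le_pow _ _ (by omega)
    calc e.cost + 1 + (p.time N + q.time N)
        ≤ (e.cost + 1) * 1 + (C * (N + 1) ^ d + C' * (N + 1) ^ d') := by
          rw [mul_one]; exact Nat.add_le_add_left (add_le_add (h N) (h' N)) _
      _ ≤ (e.cost + 1) * (N + 1) ^ (d + d') +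
          (C * (N + 1) ^ (d + d') + C' * (N + 1) ^ (d + d')) := by gcongr
      _ = _ := by ring
  | loop e p hp =>
    obtain ⟨C, d, h⟩ := hp
    refine ⟨e.cost + 1 + C, d + 1, fun N => ?_⟩
    have h₁ : 1 ≤ (N + 1) ^ d := Nat.one_le_pow _ _ (by omega)
    calc N * (e.cost + 1 + p.time N) + (e.cost + 1)
        ≤ N * (e.cost + 1 + p.time N) + (e.cost + 1 + p.time N) := by omega
      _ = (N + 1) * ((e.cost + 1) * 1 + p.time N) := by ring
      _ ≤ (N + 1) * ((e.cost + 1) * (N + 1) ^ d + C * (N + 1) ^ d) := by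
          gcongr; exact h N
      _ = _ := by ring

/-- Does the program contain an assignment to register `i`? -/
def Prog.writesReg : Prog → ℕ → Bool
  | .skip, _ => false
  | .set j _, i => i == j
  | .store _ _ _, _ => false
  | .seq p q, i => p.writesReg i || q.writesReg i
  | .cond _ p q, i => p.writesReg i || q.writesReg i
  | .loop _ p, i => p.writesReg i

/-- Does the program contain an assignment to a cell of array `a`? -/
def Prog.writesArr : Prog → ℕ → Bool
  | .skip, _ => false
  | .set _ _, _ => false
  | .store b _ _, a => a == b
  | .seq p q, a => p.writesArr a || q.writesArr a
  | .cond _ p q, a => p.writesArr a || q.writesArr a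
  | .loop _ p, a => p.writesArr a

/-- The memories `s` and `s'` differ only where the program `p` writes. -/
structure Frame (p : Prog) (s s' : Store) : Prop where
  reg : ∀ i, p.writesReg i = false → s'.reg i = s.reg i
  arr : ∀ a, p.writesArr a = false → s'.arr a = s.arr a

theorem Frame.refl (p : Prog) (s : Store) : Frame p s s := ⟨fun _ _ => rfl, fun _ _ => rfl⟩

theorem Frame.trans {p : Prog} {s s' s'' : Store} (h : Frame p s s') (h' : Frame p s' s'') :
    Frame p s s'' :=
  ⟨fun i hi => (h'.reg i hi).trans (h.reg i hi), fun a ha => (h'.arr a ha).trans (h.arr a ha)⟩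

theorem Frame.mono {p q : Prog} {s s' : Store} (h : Frame p s s')
    (hr : ∀ i, q.writesReg i = false → p.writesReg i = false)
    (ha : ∀ a, q.writesArr a = false → p.writesArr a = false) : Frame q s s' :=
  ⟨fun i hi => h.reg i (hr i hi), fun a h' => h.arr a (ha a h')⟩

/-- What a program leaves untouched can be read off its syntax. For concrete programs the side
conditions then hold by computation, so loop invariants need not mention unchanged memory. -/
theorem Exec.frame {B : ℕ} {p : Prog} {s s' : Store} {τ : ℕ} (h : Exec B p s τ s') :
    Frame p s s' := by
  induction h with
  | skip s => exact .refl _ _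
  | set s i e he =>
    refine ⟨fun j hj => ?_, fun _ _ => rfl⟩
    simp only [Prog.writesReg, beq_eq_false_iff_ne] at hj
    simp [Function.update_of_ne hj]
  | store s a d e hd he =>
    refine ⟨fun _ _ => rfl, fun b hb => ?_⟩
    simp only [Prog.writesArr, beq_eq_false_iff_ne] at hb
    simp [Function.update_of_ne hb]
  | seq hp hq ihp ihq =>
    refine (ihp.mono ?_ ?_).trans (ihq.mono ?_ ?_) <;>
      simp +contextual [Prog.writesReg, Prog.writesArr]
  | cond_true he hne hp ih =>
    refine ih.mono ?_ ?_ <;> simp +contextual [Prog.writesReg, Prog.writesArr]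
  | cond_false he hne hp ih =>
    refine ih.mono ?_ ?_ <;> simp +contextual [Prog.writesReg, Prog.writesArr]
  | loop_true he hne hp hl ihp ihl =>
    refine (ihp.mono ?_ ?_).trans ihl <;> simp +contextual [Prog.writesReg, Prog.writesArr]
  | loop_false he heq => exact .refl _ _

/-- Started with a memory `s` that is bounded by `B`, the program halts within its time bound, and
the final memory is bounded by `B` and satisfies `Q`. -/
def WP (B N : ℕ) (p : Prog) (Q : Store → Prop) (s : Store) : Prop :=
  s.Bdd B → ∃ τ s', Exec B p s τ s' ∧ τ ≤ p.time N ∧ s'.Bdd B ∧ Q s'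

namespace WP

variable {B N : ℕ} {s : Store} {Q : Store → Prop}

/-- The rule of consequence; it also supplies the frame of the program just executed, from which
preserved registers and arrays are recovered. -/
theorem mono {p : Prog} {Q' : Store → Prop} (h : WP B N p Q' s)
    (hQ : ∀ s', Frame p s s' → Q' s' → Q s') : WP B N p Q s := by
  intro hs
  obtain ⟨τ, s', he, ht, hb, hq⟩ := h hs
  exact ⟨τ, s', he, ht, hb, hQ s' he.frame hq⟩

theorem skip (h : Q s) : WP B N .skip Q s := fun hs => ⟨_, _, .skip s, le_rfl, hs, h⟩

theorem set {i : ℕ} {e : Expr} (hB : 1 ≤ B) (he : e.Small B s) (h : Q (s.setReg i (e.eval s))) :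
    WP B N (.set i e) Q s := fun hs =>
  ⟨_, _, .set s i e (he.fits hB hs), le_rfl, hs.setReg (he.fits hB hs).eval_le i, h⟩

theorem store {a : ℕ} {d e : Expr} (hB : 1 ≤ B) (hd : d.Small B s) (he : e.Small B s)
    (h : Q (s.setCell a (d.eval s) (e.eval s))) : WP B N (.store a d e) Q s := fun hs =>
  ⟨_, _, .store s a d e (hd.fits hB hs) (he.fits hB hs), le_rfl,
    hs.setCell (he.fits hB hs).eval_le a _, h⟩

theorem seq {p q : Prog} (h : WP B N p (WP B N q Q) s) : WP B N (.seq p q) Q s := by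
  intro hs
  obtain ⟨τ, s', he, ht, hb, hq⟩ := h hs
  obtain ⟨τ', s'', he', ht', hb', hq'⟩ := hq hb
  exact ⟨_, s'', he.seq he', add_le_add ht ht', hb', hq'⟩

theorem cond {e : Expr} {p q : Prog} (hB : 1 ≤ B) (he : e.Small B s)
    (hp : e.eval s ≠ 0 → WP B N p Q s) (hq : e.eval s = 0 → WP B N q Q s) :
    WP B N (.cond e p q) Q s := by
  intro hs
  by_cases h : e.eval s = 0
  · obtain ⟨τ, s', hx, ht, hb, hq⟩ := hq h hs
    exact ⟨_, s', .cond_false (he.fits hB hs) h hx, by simp only [Prog.time]; omega, hb, hq⟩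
  · obtain ⟨τ, s', hx, ht, hb, hq⟩ := hp h hs
    exact ⟨_, s', .cond_true (he.fits hB hs) h hx, by simp only [Prog.time]; omega, hb, hq⟩

/-- A `while` loop, whose number of passes is bounded by a potential `M`. -/
theorem loop_aux {e : Expr} {p : Prog} (hB : 1 ≤ B) (J : ℕ → Store → Prop)
    (he : ∀ M s, J M s → e.Small B s)
    (hp : ∀ M s, J M s → e.eval s ≠ 0 → ∃ M', M = M' + 1 ∧ WP B N p (J M') s) :
    ∀ M s, J M s → s.Bdd B → ∃ τ s', Exec B (.loop e p) s τ s' ∧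
      τ ≤ M * (e.cost + 1 + p.time N) + (e.cost + 1) ∧ s'.Bdd B ∧ e.eval s' = 0 ∧
        ∃ M', J M' s' := by
  intro M
  induction M with
  | zero =>
    intro s hJ hs
    by_cases h : e.eval s = 0
    · exact ⟨_, s, .loop_false ((he _ _ hJ).fits hB hs) h, by omega, hs, h, 0, hJ⟩
    · obtain ⟨M', hM, -⟩ := hp 0 s hJ h
      omega
  | succ M ih =>
    intro s hJ hs
    by_cases h : e.eval s = 0
    · exact ⟨_, s, .loop_false ((he _ _ hJ).fits hB hs) h, by omega, hs, h, _, hJ⟩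
    · obtain ⟨M', hM, hw⟩ := hp _ s hJ h
      obtain rfl : M = M' := by omega
      obtain ⟨τ, s₁, hx, ht, hb, hq⟩ := hw hs
      obtain ⟨τ', s₂, hx', ht', hb', hq'⟩ := ih s₁ hq hb
      refine ⟨_, s₂, .loop_true ((he _ _ hJ).fits hB hs) h hx hx', ?_, hb', hq'⟩
      rw [Nat.add_mul, one_mul]
      omega

end WP

/-- Run `body` for the values `0, 1, …` of register `i` that are smaller than register `b`. -/
def forLoop (i b : ℕ) (body : Prog) : Prog :=
  .seq (.set i (.const 0)) (.loop (.op .lt (.reg i) (.reg b))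
    (.seq body (.set i (.op .add (.reg i) (.const 1)))))

@[simp] theorem writesReg_forLoop (i b : ℕ) (body : Prog) (k : ℕ) :
    (forLoop i b body).writesReg k = (k == i || body.writesReg k) := by
  simp only [forLoop, Prog.writesReg]
  cases k == i <;> cases body.writesReg k <;> rfl

@[simp] theorem writesArr_forLoop (i b : ℕ) (body : Prog) (a : ℕ) :
    (forLoop i b body).writesArr a = body.writesArr a := by
  simp [forLoop, Prog.writesArr]

/-- The invariant is indexed by the counter and must hold after the increment, hence `setReg` in the
step. Since the body writes neither the counter nor the bound, the number of passes is the initial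
value of register `b`. -/
theorem WP.forLoop {B N : ℕ} {s : Store} {Q : Store → Prop} {i b : ℕ} {body : Prog}
    (I : ℕ → Store → Prop) (hB : 1 ≤ B) (hib : b ≠ i) (hi : body.writesReg i = false)
    (hb : body.writesReg b = false) (hN : s.reg b ≤ N) (h0 : I 0 (s.setReg i 0))
    (hstep : ∀ j < s.reg b, ∀ s', Frame (forLoop i b body) s s' → s'.reg i = j → I j s' →
      WP B N body (fun s'' => I (j + 1) (s''.setReg i (j + 1))) s')
    (hQ : ∀ s', Frame (WordRAM.forLoop i b body) s s' → I (s.reg b) s' → Q s') :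
    WP B N (WordRAM.forLoop i b body) Q s := by
  intro hs
  have hbB := hs.1 b
  -- The potential `M` is the number of remaining passes.
  set J : ℕ → Store → Prop := fun M s' =>
    Frame (WordRAM.forLoop i b body) s s' ∧ s'.reg i + M = s.reg b ∧ I (s'.reg i) s' with hJ
  have hJb : ∀ M s', J M s' → s'.reg b = s.reg b := fun M s' h =>
    h.1.reg b (by simp [hb, hib])
  have hf0 : Frame (WordRAM.forLoop i b body) s (s.setReg i 0) := by
    refine ⟨fun k hk => ?_, fun _ _ => rfl⟩
    simp only [writesReg_forLoop, Bool.or_eq_false_iff, beq_eq_false_iff_ne] at hk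
    simp [hk.1]
  obtain ⟨τ, s', hx, ht, hbd, hz, M', h1, h2, h3⟩ := WP.loop_aux (N := N)
    (e := .op .lt (.reg i) (.reg b)) (p := .seq body (.set i (.op .add (.reg i) (.const 1)))) hB J
    (fun M s' h => by simp [Expr.Small]) (by
      intro M s' h hne
      have hlt : s'.reg i < s.reg b := by
        rw [← hJb M s' h]; by_contra hc
        simp [Expr.eval, Op.apply, hc] at hne
      refine ⟨M - 1, by have := h.2.1; omega, .seq ?_⟩
      refine (hstep _ hlt s' h.1 rfl h.2.2).mono fun s'' hf hI => ?_
      have hi' : s''.reg i = s'.reg i := hf.reg i hi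
      refine .set hB ?_ ⟨?_, ?_, ?_⟩
      · simp only [Expr.Small, Expr.eval, true_and, hi']; omega
      · refine (h.1.trans (hf.mono ?_ ?_)).trans ⟨fun k hk => ?_, fun _ _ => rfl⟩
        · simp +contextual
        · simp
        · simp only [writesReg_forLoop, Bool.or_eq_false_iff, beq_eq_false_iff_ne] at hk
          simp [hk.1]
      · have := h.2.1
        simp [Expr.eval, Op.apply, hi']; omega
      · simpa [Expr.eval, Op.apply, hi'] using hI)
    (s.reg b) (s.setReg i 0) ⟨hf0, by simp, by simpa using h0⟩ (hs.setReg (Nat.zero_le _) i)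
  refine ⟨_, s', .seq (.set s i (.const 0) (Nat.zero_le _)) hx, ?_, hbd, hQ s' h1 ?_⟩
  · simp only [WordRAM.forLoop, Prog.time]
    have := Nat.mul_le_mul_right (Expr.cost (.op .lt (.reg i) (.reg b)) + 1 +
      Prog.time N (.seq body (.set i (.op .add (.reg i) (.const 1))))) hN
    simp only [Prog.time] at this ht
    omega
  · have : s'.reg i = s.reg b := by
      have h4 := hJb M' s' ⟨h1, h2, h3⟩
      by_contra hc
      simp [Expr.eval, Op.apply, h4] at hz
      omega
    rwa [this] at h3

end WordRAM

/-! ## Branching on incompatible pairs of vertices -/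

namespace TwoClub

variable {n : ℕ}

/-- The number of undecided vertices, where a vertex is undecided, kept or deleted if its status is
`0`, `1` or `2`. -/
def undecided (f : Fin n → ℕ) : ℕ := (Finset.univ.filter fun v => f v = 0).card

/-- The set of vertices that are not deleted. -/
def alive (f : Fin n → ℕ) : Finset (Fin n) := Finset.univ.filter fun v => f v < 2

theorem mem_alive {f : Fin n → ℕ} {v : Fin n} : v ∈ alive f ↔ f v < 2 := by simp [alive]

/-- `S` contains the vertices kept by `f` and no deleted ones. -/
def Extends (f : Fin n → ℕ) (S : Finset (Fin n)) : Prop :=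
  (∀ v, f v = 1 → v ∈ S) ∧ S ⊆ alive f

/-- Some solution extends the partial decisions `f`. -/
def HasSol (sol : Finset (Fin n) → Prop) (f : Fin n → ℕ) : Prop := ∃ S, Extends f S ∧ sol S

/-- No solution that extends `f` contains both `u` and `v`. -/
def Incompatible (sol : Finset (Fin n) → Prop) (f : Fin n → ℕ) (u v : Fin n) : Prop :=
  ∀ S, Extends f S → sol S → u ∈ S → v ∈ S → False

theorem undecided_update {f : Fin n → ℕ} {v : Fin n} {x : ℕ} (hv : f v = 0) (hx : x ≠ 0) :
    undecided (Function.update f v x) + 1 = undecided f := by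
  have : (Finset.univ.filter fun w => f w = 0) =
      insert v (Finset.univ.filter fun w => Function.update f v x w = 0) := by
    ext w
    by_cases h : w = v
    · subst h; simp [hv]
    · simp [h]
  rw [undecided, undecided, this, Finset.card_insert_of_notMem (by simp [hx])]

theorem extends_update_delete {f : Fin n → ℕ} {v : Fin n} {S : Finset (Fin n)} (hv : f v = 0) :
    Extends (Function.update f v 2) S ↔ Extends f S ∧ v ∉ S := by
  constructor
  · rintro ⟨h1, h2⟩
    have hvS : v ∉ S := fun h => by simpa [mem_alive] using h2 h
    refine ⟨⟨fun w hw => h1 w ?_, fun w hw => ?_⟩, hvS⟩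
    · rw [Function.update_of_ne (by rintro rfl; omega), hw]
    · have := h2 hw
      rwa [mem_alive, Function.update_of_ne (by rintro rfl; exact hvS hw), ← mem_alive] at this
  · rintro ⟨⟨h1, h2⟩, hvS⟩
    refine ⟨fun w hw => ?_, fun w hw => ?_⟩
    · by_cases h : w = v
      · subst h; simp at hw
      · exact h1 w (by rwa [Function.update_of_ne h] at hw)
    · rw [mem_alive, Function.update_of_ne (by rintro rfl; exact hvS hw), ← mem_alive]
      exact h2 hw

theorem extends_update_keep {f : Fin n → ℕ} {v : Fin n} {S : Finset (Fin n)} (hv : f v = 0) :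
    Extends (Function.update f v 1) S ↔ Extends f S ∧ v ∈ S := by
  constructor
  · rintro ⟨h1, h2⟩
    refine ⟨⟨fun w hw => h1 w ?_, fun w hw => ?_⟩, h1 v (by simp)⟩
    · rw [Function.update_of_ne (by rintro rfl; omega), hw]
    · by_cases h : w = v
      · subst h; simp [mem_alive, hv]
      · have := h2 hw
        rwa [mem_alive, Function.update_of_ne h, ← mem_alive] at this
  · rintro ⟨⟨h1, h2⟩, hvS⟩
    refine ⟨fun w hw => ?_, fun w hw => ?_⟩
    · by_cases h : w = v
      · subst h; exact hvS
      · exact h1 w (by rwa [Function.update_of_ne h] at hw)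
    · by_cases h : w = v
      · subst h; simp [mem_alive]
      · rw [mem_alive, Function.update_of_ne h, ← mem_alive]
        exact h2 hw

variable {sol : Finset (Fin n) → Prop} {f : Fin n → ℕ} {u v : Fin n}

theorem Incompatible.symm (h : Incompatible sol f u v) : Incompatible sol f v u :=
  fun S h1 h2 h3 h4 => h S h1 h2 h4 h3

theorem Incompatible.not_hasSol (h : Incompatible sol f u v) (hu : f u = 1) (hv : f v = 1) :
    ¬ HasSol sol f := fun ⟨S, hS, hs⟩ => h S hS hs (hS.1 u hu) (hS.1 v hv)

theorem Incompatible.hasSol_delete (h : Incompatible sol f u v) (hu : f u = 1) (hv : f v = 0) :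
    HasSol sol (Function.update f v 2) ↔ HasSol sol f := by
  simp only [HasSol, extends_update_delete hv]
  exact ⟨fun ⟨S, hS, hs⟩ => ⟨S, hS.1, hs⟩,
    fun ⟨S, hS, hs⟩ => ⟨S, ⟨hS, fun hvS => h S hS hs (hS.1 u hu) hvS⟩, hs⟩⟩

/-- A solution either avoids `u`, or contains `u` and therefore avoids `v`. Recording in the second
case that `u` is kept is what makes two vertices decided there. -/
theorem Incompatible.hasSol_branch (h : Incompatible sol f u v) (huv : u ≠ v) (hu : f u = 0)
    (hv : f v = 0) :
    HasSol sol (Function.update f u 2) ∨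
      HasSol sol (Function.update (Function.update f u 1) v 2) ↔ HasSol sol f := by
  have hv' : Function.update f u 1 v = 0 := by rw [Function.update_of_ne huv.symm, hv]
  simp only [HasSol, extends_update_delete hu, extends_update_delete hv', extends_update_keep hu]
  constructor
  · rintro (⟨S, hS, hs⟩ | ⟨S, hS, hs⟩)
    exacts [⟨S, hS.1, hs⟩, ⟨S, hS.1.1, hs⟩]
  · rintro ⟨S, hS, hs⟩
    by_cases huS : u ∈ S
    · exact .inr ⟨S, ⟨⟨hS, huS⟩, fun hvS => h S hS hs huS hvS⟩, hs⟩
    · exact .inl ⟨S, ⟨hS, huS⟩, hs⟩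

/-- The number of nodes of the search tree for `m` undecided vertices. -/
def treeSize : ℕ → ℕ
  | 0 => 1
  | 1 => 2
  | m + 2 => treeSize (m + 1) + treeSize m + 1

theorem treeSize_pos : ∀ m, 1 ≤ treeSize m
  | 0 => le_rfl
  | 1 => by simp [treeSize]
  | m + 2 => by simp [treeSize]

/-- Pays for a forced deletion, where a node is processed and replaced by a single child with one
undecided vertex less. -/
theorem treeSize_succ_lt (m : ℕ) : treeSize m + 1 ≤ treeSize (m + 1) := by
  cases m with
  | zero => simp [treeSize]
  | succ m => simp only [treeSize]; omega

/-- Adding one makes the recurrence homogeneous: `T (m + 2) + 1 = (T (m + 1) + 1) + (T m + 1)`. The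
induction then needs only `1.619 + 1 ≤ 1.619 ^ 2`, and the factor `3` covers the base cases. -/
theorem treeSize_le (m : ℕ) : (treeSize m : ℝ) + 1 ≤ 3 * 1.619 ^ m := by
  induction m using Nat.strong_induction_on with
  | _ m ih =>
    match m with
    | 0 => norm_num [treeSize]
    | 1 => norm_num [treeSize]
    | m + 2 =>
      have h1 := ih (m + 1) (by omega)
      have h2 := ih m (by omega)
      have h3 : (0 : ℝ) < 1.619 ^ m := by positivity
      simp only [treeSize, Nat.cast_add, Nat.cast_one, pow_succ] at h1 h2 ⊢
      nlinarith

/-- The invariant of the search: `items 0, …, items (sp - 1)` are the open nodes of the search tree,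
`found` tells whether a solution has been found, and `M` bounds the number of remaining nodes. -/
structure Search (sol : Finset (Fin n) → Prop) (P : Prop) (sp found M : ℕ)
    (items : ℕ → Fin n → ℕ) : Prop where
  undecided_le : ∀ d < sp, undecided (items d) + d ≤ n
  le_two : ∀ d < sp, ∀ v, items d v ≤ 2
  found_le : found ≤ 1
  iff : (found = 1 ∨ ∃ d < sp, HasSol sol (items d)) ↔ P
  potential : ∑ d ∈ Finset.range sp, treeSize (undecided (items d)) ≤ M

namespace Search

variable {P : Prop} {d found found' M : ℕ} {items items' : ℕ → Fin n → ℕ}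

theorem pos (h : Search sol P (d + 1) found M items) : 1 ≤ M := by
  have := h.potential
  rw [Finset.sum_range_succ] at this
  have := treeSize_pos (undecided (items d))
  omega

theorem sum_congr {g : (Fin n → ℕ) → ℕ} (hi : ∀ d' < d, items' d' = items d') :
    ∑ e ∈ Finset.range d, g (items' e) = ∑ e ∈ Finset.range d, g (items e) :=
  Finset.sum_congr rfl fun e he => by rw [hi e (Finset.mem_range.1 he)]

theorem exists_hasSol_congr (hi : ∀ d' < d, items' d' = items d') :
    (∃ e < d, HasSol sol (items' e)) ↔ ∃ e < d, HasSol sol (items e) :=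
  exists_congr fun e => and_congr_right fun he => by rw [hi e he]

theorem exists_lt_succ {p : ℕ → Prop} : (∃ e < d + 1, p e) ↔ (∃ e < d, p e) ∨ p d := by
  constructor
  · rintro ⟨e, he, hp⟩
    rcases Nat.lt_succ_iff_lt_or_eq.1 he with h | rfl
    exacts [.inl ⟨e, h, hp⟩, .inr hp]
  · rintro (⟨e, he, hp⟩ | hp)
    exacts [⟨e, by omega, hp⟩, ⟨d, by omega, hp⟩]

/-- The topmost node is a leaf: it is either contradictory or settled by its size, and its outcome
moves into `found'`. -/
theorem pop (h : Search sol P (d + 1) found M items) (hf : found' ≤ 1)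
    (hs : found' = 1 ↔ found = 1 ∨ HasSol sol (items d)) (hi : ∀ d' < d, items' d' = items d') :
    Search sol P d found' (M - 1) items' where
  undecided_le e he := by rw [hi e he]; exact h.undecided_le e (by omega)
  le_two e he := by rw [hi e he]; exact h.le_two e (by omega)
  found_le := hf
  iff := by
    rw [← h.iff, exists_lt_succ, exists_hasSol_congr hi, hs, or_assoc,
      or_comm (a := HasSol sol (items d))]
  potential := by
    rw [sum_congr (g := fun f => treeSize (undecided f)) hi]
    have := h.potential
    rw [Finset.sum_range_succ] at this
    have := treeSize_pos (undecided (items d))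
    omega

/-- The topmost node has a forced deletion, so it is overwritten by its only child. -/
theorem replace (h : Search sol P (d + 1) found M items)
    (hs : HasSol sol (items' d) ↔ HasSol sol (items d)) (hle : ∀ v, items' d v ≤ 2)
    (hu : undecided (items' d) + 1 = undecided (items d)) (hi : ∀ d' < d, items' d' = items d') :
    Search sol P (d + 1) found (M - 1) items' where
  undecided_le e he := by
    rcases Nat.lt_succ_iff_lt_or_eq.1 he with h' | rfl
    · rw [hi e h']; exact h.undecided_le e he
    · have := h.undecided_le e he; omega
  le_two e he := by
    rcases Nat.lt_succ_iff_lt_or_eq.1 he with h' | rfl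
    · rw [hi e h']; exact h.le_two e he
    · exact hle
  found_le := h.found_le
  iff := by
    rw [← h.iff, exists_lt_succ, exists_lt_succ, exists_hasSol_congr hi, hs]
  potential := by
    have := h.potential
    rw [Finset.sum_range_succ] at this ⊢
    rw [sum_congr (g := fun f => treeSize (undecided f)) hi]
    have := treeSize_succ_lt (undecided (items' d))
    rw [hu] at this
    omega

/-- The topmost node is overwritten by its first child, and the second child is pushed. The
recurrence of `treeSize` accounts for both children and the processed node. -/
theorem branch (h : Search sol P (d + 1) found M items)
    (hs : HasSol sol (items' d) ∨ HasSol sol (items' (d + 1)) ↔ HasSol sol (items d))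
    (hle : ∀ v, items' d v ≤ 2) (hle' : ∀ v, items' (d + 1) v ≤ 2)
    (hu : undecided (items' d) + 1 = undecided (items d))
    (hu' : undecided (items' (d + 1)) + 2 = undecided (items d))
    (hi : ∀ d' < d, items' d' = items d') :
    Search sol P (d + 2) found (M - 1) items' where
  undecided_le e he := by
    rcases Nat.lt_succ_iff_lt_or_eq.1 he with he | rfl
    · rcases Nat.lt_succ_iff_lt_or_eq.1 he with h' | rfl
      · rw [hi e h']; exact h.undecided_le e he
      · have := h.undecided_le e he; omega
    -- The second child lies one place higher on the stack but has two undecided vertices less; this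
    -- is why the height of the stack stays linear in `n`.
    · have := h.undecided_le d (by omega); omega
  le_two e he := by
    rcases Nat.lt_succ_iff_lt_or_eq.1 he with he | rfl
    · rcases Nat.lt_succ_iff_lt_or_eq.1 he with h' | rfl
      · rw [hi e h']; exact h.le_two e he
      · exact hle
    · exact hle'
  found_le := h.found_le
  iff := by
    rw [← h.iff, exists_lt_succ, exists_lt_succ, exists_lt_succ, exists_hasSol_congr hi, ← hs,
      or_assoc (a := ∃ e < d, _)]
  potential := by
    have := h.potential
    rw [Finset.sum_range_succ] at this
    rw [Finset.sum_range_succ, Finset.sum_range_succ,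
      sum_congr (g := fun f => treeSize (undecided f)) hi]
    obtain ⟨m, hm⟩ : ∃ m, undecided (items' (d + 1)) = m := ⟨_, rfl⟩
    have h1 : undecided (items' d) = m + 1 := by omega
    have h2 : undecided (items d) = m + 2 := by omega
    rw [h2, treeSize] at this
    rw [hm, h1]
    omega

end Search

end TwoClub

/-! ## The search program -/

namespace WordRAM

open TwoClub

open Classical in
/-- Registers `0` and `1` hold the number of vertices and `t`, and array `0` holds the adjacency
matrix of `G`. -/
structure Enc {n : ℕ} (G : SimpleGraph (Fin n)) (t : ℕ) (s : Store) : Prop where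
  size : s.reg 0 = n
  param : s.reg 1 = t
  adj : ∀ i j : Fin n, s.arr 0 (i * n + j) = if G.Adj i j then 1 else 0

/-- Array `2` holds the characteristic vector of `S`. -/
def EncSet {n : ℕ} (S : Finset (Fin n)) (s : Store) : Prop :=
  ∀ v : Fin n, s.arr 2 v = if v ∈ S then 1 else 0

theorem Enc.of_eq {n t : ℕ} {G : SimpleGraph (Fin n)} {s s' : Store} (h : Enc G t s)
    (h0 : s'.reg 0 = s.reg 0) (h1 : s'.reg 1 = s.reg 1) (h2 : s'.arr 0 = s.arr 0) : Enc G t s' :=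
  ⟨h0.trans h.size, h1.trans h.param, fun i j => by rw [h2]; exact h.adj i j⟩

theorem EncSet.of_eq {n : ℕ} {S : Finset (Fin n)} {s s' : Store} (h : EncSet S s)
    (h2 : s'.arr 2 = s.arr 2) : EncSet S s' := fun v => by rw [h2]; exact h v

/-- Pairs of vertices that obstruct a set of vertices from being a solution. -/
abbrev Obstruction : Type :=
  (n : ℕ) → SimpleGraph (Fin n) → (t : ℕ) → Finset (Fin n) → Fin n → Fin n → Prop

open Classical in
/-- The program `p` tests whether the vertices in registers `9` and `10` form an obstruction for
the set in array `2`, and puts the answer into register `11`. -/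
structure IsTest (bad : Obstruction) (p : Prog) : Prop where
  reg : ∀ i < 20, i ≠ 11 → p.writesReg i = false
  arr : ∀ a < 3, p.writesArr a = false
  correct : ∀ {n : ℕ} (G : SimpleGraph (Fin n)) (t : ℕ) (S : Finset (Fin n)) (B N : ℕ) (s : Store)
    (u v : Fin n), 16 * (n + 2) ^ 2 ≤ B → 2 * n ≤ N → Enc G t s → EncSet S s →
    s.reg 9 = u → s.reg 10 = v → u ∈ S → v ∈ S → u ≠ v →
    WP B N p (fun s' => s'.reg 11 = if bad n G t S u v then 1 else 0) s

/-- Search for an obstruction for the set in array `2`. If there is one, then register `6` becomes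
`1` and the obstruction is put into registers `7` and `8`; otherwise, register `6` becomes `0`. -/
def findBad (test : Prog) : Prog :=
  .seq (.set 6 (.const 0))
    (forLoop 9 0 (forLoop 10 0
      (.cond (.cell 2 (.reg 9))
        (.cond (.cell 2 (.reg 10))
          (.cond (.op .eq (.reg 9) (.reg 10)) .skip
            (.seq test
              (.cond (.reg 11)
                (.seq (.set 6 (.const 1)) (.seq (.set 7 (.reg 9)) (.set 8 (.reg 10))))
                .skip)))
          .skip)
        .skip)))

/-- The result of the search for an obstruction among the pairs that satisfy `R`. -/
def Found {n : ℕ} (bad : Fin n → Fin n → Prop) (S : Finset (Fin n)) (R : ℕ → ℕ → Prop)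
    (s : Store) : Prop :=
  (s.reg 6 = 0 ∧ ∀ u ∈ S, ∀ v ∈ S, R u v → u ≠ v → ¬ bad u v) ∨
    (s.reg 6 = 1 ∧ ∃ u ∈ S, ∃ v ∈ S, u ≠ v ∧ bad u v ∧ s.reg 7 = u ∧ s.reg 8 = v)

/-- Enlarges the range of examined pairs: every new pair has to be an old one or harmless. A pair
already found remains valid whatever the range is. -/
theorem Found.of_eq {n : ℕ} {bad : Fin n → Fin n → Prop} {S : Finset (Fin n)}
    {R R' : ℕ → ℕ → Prop} {s s' : Store} (h : Found bad S R s) (h6 : s'.reg 6 = s.reg 6)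
    (h7 : s'.reg 7 = s.reg 7) (h8 : s'.reg 8 = s.reg 8)
    (hR : ∀ u ∈ S, ∀ v ∈ S, R' u v → u ≠ v → R u v ∨ ¬ bad u v) : Found bad S R' s' := by
  rcases h with ⟨h, h'⟩ | h
  · refine .inl ⟨h6.trans h, fun u hu v hv huv hne => ?_⟩
    rcases hR u hu v hv huv hne with h | h
    exacts [h' u hu v hv h hne, h]
  · refine .inr ?_
    rw [h6, h7, h8]
    exact h

theorem one_le_of_bound {n B : ℕ} (hB : 16 * (n + 2) ^ 2 ≤ B) : 64 ≤ B := by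
  have : 2 ^ 2 ≤ (n + 2) ^ 2 := Nat.pow_le_pow_left (by omega) 2
  omega

theorem findBad_spec {bad : Obstruction} {test : Prog} (ht : IsTest bad test) {n : ℕ}
    (G : SimpleGraph (Fin n)) (t : ℕ) (S : Finset (Fin n)) {B N : ℕ} {s : Store}
    (hB : 16 * (n + 2) ^ 2 ≤ B) (hN : 2 * n ≤ N) (hE : Enc G t s) (hS : EncSet S s) :
    WP B N (findBad test) (Found (bad n G t S) S fun _ _ => True) s := by
  have hB1 : 1 ≤ B := by have := one_le_of_bound hB; omega
  have hr : ∀ i < 20, i ≠ 11 → test.writesReg i = false := ht.reg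
  have ha : ∀ a < 3, test.writesArr a = false := ht.arr
  refine .seq (.set hB1 (by simp [Expr.Small]) ?_)
  simp only [Expr.eval]
  refine .forLoop (fun i s' => Found (bad n G t S) S (fun u _ => u < i) s') hB1 (by omega)
    (by simp [Prog.writesReg, hr]) (by simp [Prog.writesReg, hr]) (by simp [hE.size]; omega) ?_ ?_ ?_
  · refine .inl ⟨by simp, by simp⟩
  · intro i hi s1 hf1 h1i hI1
    simp only [Store.setReg_reg] at hi
    have h10 : s1.reg 0 = n := by
      rw [hf1.reg 0 (by simp [Prog.writesReg, hr])]; simpa using hE.size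
    have hin : i < n := by simpa [hE.size] using hi
    refine .forLoop (fun j s' => Found (bad n G t S) S (fun u v => u < i ∨ (u = i ∧ v < j)) s') hB1
      (by omega) (by simp [Prog.writesReg, hr]) (by simp [Prog.writesReg, hr]) (by omega) ?_ ?_ ?_
    · exact hI1.of_eq (by simp) (by simp) (by simp) fun u _ v _ h _ => .inl (by omega)
    · intro j hj s2 hf2 h2j hI2
      rw [h10] at hj
      have hf := hf1.trans (hf2.mono (q := forLoop 9 0 _) (by simp +contextual) (by simp))
      have h20 : s2.reg 0 = s.reg 0 := by
        rw [hf.reg 0 (by simp [Prog.writesReg, hr])]; simp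
      have h21 : s2.reg 1 = s.reg 1 := by
        rw [hf.reg 1 (by simp [Prog.writesReg, hr])]; simp
      have h2a0 : s2.arr 0 = s.arr 0 := by
        rw [hf.arr 0 (by simp [Prog.writesArr, ha])]; simp
      have h2a2 : s2.arr 2 = s.arr 2 := by
        rw [hf.arr 2 (by simp [Prog.writesArr, ha])]; simp
      have h2i : s2.reg 9 = i := by
        rw [hf2.reg 9 (by simp [Prog.writesReg, hr]), h1i]
      have hE2 : Enc G t s2 := hE.of_eq h20 h21 h2a0
      have hS2 : EncSet S s2 := hS.of_eq h2a2
      have hc1 := hS2 ⟨i, hin⟩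
      have hc2 := hS2 ⟨j, hj⟩
      simp only at hc1 hc2
      -- Shared by all branches that leave the result unchanged: if the pair `(i, j)` is not an
      -- obstruction, the examined range extends by it.
      have key : (∀ (hu : (⟨i, hin⟩ : Fin n) ∈ S) (hv : (⟨j, hj⟩ : Fin n) ∈ S), i ≠ j →
          ¬ bad n G t S ⟨i, hin⟩ ⟨j, hj⟩) → ∀ s3 : Store, s3.reg 6 = s2.reg 6 →
          s3.reg 7 = s2.reg 7 → s3.reg 8 = s2.reg 8 →
          Found (bad n G t S) S (fun u v => u < i ∨ (u = i ∧ v < j + 1)) (s3.setReg 10 (j + 1)) := by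
        intro hk s3 h6 h7 h8
        refine hI2.of_eq (by simpa using h6) (by simpa using h7) (by simpa using h8) ?_
        intro u hu v hv huv hne
        by_cases h : (u : ℕ) = i ∧ (v : ℕ) = j
        · obtain rfl : u = ⟨i, hin⟩ := Fin.ext h.1
          obtain rfl : v = ⟨j, hj⟩ := Fin.ext h.2
          exact .inr (hk hu hv fun hij => hne (by simp [hij]))
        · exact .inl (by omega)
      refine .cond hB1 (by simp [Expr.Small]) (fun h => ?_) (fun h => ?_)
      swap
      · refine .skip (key (fun hu _ _ => ?_) s2 rfl rfl rfl)
        simp [Expr.eval, h2i, hc1, hu] at h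
      have hu : (⟨i, hin⟩ : Fin n) ∈ S := by
        by_contra hc; simp [Expr.eval, h2i, hc1, hc] at h
      refine .cond hB1 (by simp [Expr.Small]) (fun h => ?_) (fun h => ?_)
      swap
      · refine .skip (key (fun _ hv _ => ?_) s2 rfl rfl rfl)
        simp [Expr.eval, h2j, hc2, hv] at h
      have hv : (⟨j, hj⟩ : Fin n) ∈ S := by
        by_contra hc; simp [Expr.eval, h2j, hc2, hc] at h
      refine .cond hB1 (by simp [Expr.Small]) (fun h => ?_) (fun h => ?_)
      · refine .skip (key (fun _ _ hij => ?_) s2 rfl rfl rfl)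
        simp [Expr.eval, Op.apply, h2i, h2j, hij] at h
      have hij : i ≠ j := by
        rintro rfl; simp [Expr.eval, Op.apply, h2i, h2j] at h
      refine .seq ((ht.correct G t S B N s2 ⟨i, hin⟩ ⟨j, hj⟩ hB hN hE2 hS2 h2i h2j hu hv
        (by simpa using hij)).mono fun s3 hf3 h3 => ?_)
      have h36 := hf3.reg 6 (hr 6 (by omega) (by omega))
      have h37 := hf3.reg 7 (hr 7 (by omega) (by omega))
      have h38 := hf3.reg 8 (hr 8 (by omega) (by omega))
      have h39 := hf3.reg 9 (hr 9 (by omega) (by omega))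
      have h310 := hf3.reg 10 (hr 10 (by omega) (by omega))
      refine .cond hB1 (by simp [Expr.Small]) (fun h => ?_) (fun h => ?_)
      · have hbad : bad n G t S ⟨i, hin⟩ ⟨j, hj⟩ := by
          by_contra hc; simp [Expr.eval, h3, hc] at h
        refine .seq (.set hB1 (by simpa [Expr.Small] using hB1) (.seq (.set hB1 (by simp [Expr.Small])
          (.set hB1 (by simp [Expr.Small]) ?_))))
        refine .inr ⟨by simp [Expr.eval], ⟨i, hin⟩, hu, ⟨j, hj⟩, hv, by simpa using hij, hbad,
          by simp [Expr.eval, h39, h2i], by simp [Expr.eval, h310, h2j]⟩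
      · refine .skip (key (fun _ _ _ hb => ?_) s3 h36 h37 h38)
        simp [Expr.eval, h3, hb] at h
    · intro s2 hf2 hI2
      rw [h10] at hI2
      refine hI2.of_eq (by simp) (by simp) (by simp) fun u _ v _ h _ => .inl ?_
      have := v.2
      omega
  · intro s1 hf1 hI1
    simp only [Store.setReg_reg] at hI1
    refine hI1.of_eq rfl rfl rfl fun u _ v _ _ _ => .inl ?_
    simp [hE.size]

end WordRAM

/-! ### Processing one node of the search tree -/

namespace WordRAM

open TwoClub

/-- The statuses of the vertices in the `d`-th open node of the search tree. -/
def item (n : ℕ) (s : Store) (d : ℕ) : Fin n → ℕ := fun v => s.arr 1 (d * n + v)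

/-- The ranges are generous enough to cover both the stack of vectors of length `n` and the matrix
of the network with `2 * n` nodes. -/
theorem index_le {n m B d v : ℕ} (hB : 16 * (n + 2) ^ 2 ≤ B) (hm : m ≤ 2 * n) (hd : d ≤ 2 * n + 1)
    (hv : v ≤ 2 * n) : d * m + v ≤ B := by
  have := Nat.mul_le_mul hd hm
  nlinarith

theorem index_inj {n d d' v v' : ℕ} (hv : v < n) (hv' : v' < n) :
    d * n + v = d' * n + v' ↔ d = d' ∧ v = v' := by
  refine ⟨fun h => ?_, by rintro ⟨rfl, rfl⟩; rfl⟩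
  rcases lt_trichotomy d d' with hd | rfl | hd
  · have := Nat.mul_le_mul_right n (Nat.succ_le_of_lt hd)
    rw [Nat.succ_mul] at this; omega
  · exact ⟨rfl, by omega⟩
  · have := Nat.mul_le_mul_right n (Nat.succ_le_of_lt hd)
    rw [Nat.succ_mul] at this; omega

theorem item_setCell {n d x : ℕ} (s : Store) (v : Fin n) :
    item n (s.setCell 1 (d * n + v) x) =
      Function.update (item n s) d (Function.update (item n s d) v x) := by
  funext d' w
  simp only [item, Store.setCell_arr, true_and, index_inj w.2 v.2]
  by_cases hd : d' = d
  · subst hd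
    by_cases hw : w = v
    · subst hw; simp
    · simp [hw, Fin.val_inj, item]
  · simp [hd, item]

theorem item_of_eq {n : ℕ} {s s' : Store} (h : s'.arr 1 = s.arr 1) : item n s' = item n s := by
  funext d v; simp [item, h]

theorem item_setReg {n i x : ℕ} (s : Store) : item n (s.setReg i x) = item n s := rfl

/-- Put the characteristic vector of the vertices that are not deleted into array `2`. -/
def loadSet : Prog :=
  forLoop 12 0 (.store 2 (.reg 12)
    (.op .lt (.cell 1 (.op .add (.reg 5) (.reg 12))) (.const 2)))

theorem loadSet_spec {n d B N : ℕ} {s : Store} (hB : 16 * (n + 2) ^ 2 ≤ B) (hN : 2 * n ≤ N)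
    (hn : s.reg 0 = n) (h5 : s.reg 5 = d * n) (hd : d ≤ n) :
    WP B N loadSet (EncSet (alive (item n s d))) s := by
  have hB1 := one_le_of_bound hB
  refine .forLoop (fun j s' => ∀ v : Fin n, (v : ℕ) < j →
    s'.arr 2 v = if v ∈ alive (item n s d) then 1 else 0) (by omega) (by omega) rfl rfl (by omega)
    (by simp) ?_ ?_
  · intro j hj s1 hf h12 hI
    have h15 : s1.reg 5 = s.reg 5 := hf.reg 5 rfl
    have h1 : s1.arr 1 = s.arr 1 := hf.arr 1 rfl
    have := index_le (d := d) (m := n) (v := j) hB (by omega) (by omega) (by omega)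
    refine .store (by omega) (by simp [Expr.Small]) ?_ ?_
    · simp [Expr.Small, Expr.eval, h15, h5, h12]; omega
    · intro v hv
      simp only [Expr.eval, Op.apply, Store.setReg_arr, Store.setCell_arr, true_and, h12, h15, h5, h1]
      by_cases h : (v : ℕ) = j
      · simp [h, mem_alive, item]
      · rw [if_neg h]; exact hI v (by omega)
  · intro s' hf hI v
    exact hI v (by rw [hn]; exact v.2)

/-- Put the number of elements of the set in array `2` into register `13`. -/
def countSet : Prog :=
  .seq (.set 13 (.const 0)) (forLoop 12 0 (.set 13 (.op .add (.reg 13) (.cell 2 (.reg 12)))))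

theorem countSet_spec {n B N : ℕ} {s : Store} {S : Finset (Fin n)} (hB : 16 * (n + 2) ^ 2 ≤ B)
    (hN : 2 * n ≤ N) (hn : s.reg 0 = n) (hS : EncSet S s) :
    WP B N countSet (fun s' => s'.reg 13 = S.card) s := by
  have hB1 := one_le_of_bound hB
  refine .seq (.set (by omega) (by simp [Expr.Small]) ?_)
  refine .forLoop (fun j s' => s'.reg 13 = ∑ w ∈ Finset.range j, s.arr 2 w) (by omega) (by omega)
    rfl rfl (by simp; omega) (by simp [Expr.eval]) ?_ ?_
  · intro j hj s1 hf h12 hI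
    replace hj : j < n := by simpa [hn] using hj
    have h1 : s1.arr 2 = s.arr 2 := hf.arr 2 rfl
    have hle : ∀ w ∈ Finset.range (j + 1), s.arr 2 w ≤ 1 := by
      intro w hw
      rw [Finset.mem_range] at hw
      have := hS ⟨w, by omega⟩
      simp only at this
      rw [this]; split_ifs <;> omega
    have hsum := Finset.sum_le_card_nsmul _ _ _ hle
    rw [Finset.card_range, Finset.sum_range_succ, smul_eq_mul, mul_one] at hsum
    have : n ≤ B := by nlinarith
    refine .set (by omega) ?_ ?_
    · simp [Expr.Small, Expr.eval, h1, hI, h12]; omega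
    · simp [Expr.eval, Op.apply, h1, hI, h12, Finset.sum_range_succ]
  · intro s' hf hI
    simp only [Store.setReg_reg, hn] at hI
    simp only [hI, Finset.sum_range, if_neg (by omega : ¬ 0 = 13)]
    simp [hS _]

/-- Copy the topmost open node. -/
def copyItem : Prog :=
  forLoop 12 0 (.store 1 (.op .add (.op .add (.reg 5) (.reg 0)) (.reg 12))
    (.cell 1 (.op .add (.reg 5) (.reg 12))))

/-- With `min d' d`, one equation says both that the nodes up to `d` are intact and that node `d +
1` is a copy of node `d`. -/
theorem copyItem_spec {n d B N : ℕ} {s : Store} (hB : 16 * (n + 2) ^ 2 ≤ B) (hN : 2 * n ≤ N)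
    (hn : s.reg 0 = n) (h5 : s.reg 5 = d * n) (hd : d ≤ n) :
    WP B N copyItem (fun s' => ∀ d' ≤ d + 1, item n s' d' = item n s (min d' d)) s := by
  have hB1 := one_le_of_bound hB
  refine .forLoop (fun j s' => ∀ d' ≤ d + 1, ∀ v : Fin n, d' ≤ d ∨ (v : ℕ) < j →
    s'.arr 1 (d' * n + v) = item n s (min d' d) v) (by omega) (by omega) rfl rfl (by omega)
    ?_ ?_ ?_
  · intro d' _ v hv
    have : d' ≤ d := by omega
    simp [item, min_eq_left this]
  · intro j hj s1 hf h12 hI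
    rw [hn] at hj
    have h15 : s1.reg 5 = s.reg 5 := hf.reg 5 rfl
    have h10 : s1.reg 0 = s.reg 0 := hf.reg 0 rfl
    have h1 := index_le (d := d) (m := n) (v := j) hB (by omega) (by omega) (by omega)
    have h2 := index_le (d := d + 1) (m := n) (v := j) hB (by omega) (by omega) (by omega)
    rw [Nat.succ_mul] at h2
    refine .store (by omega) ?_ ?_ ?_
    · simp [Expr.Small, Expr.eval, Op.apply, h15, h5, h12, h10, hn]; omega
    · simp [Expr.Small, Expr.eval, h15, h5, h12]; omega
    · intro d' hd' v hv
      -- The source cell belongs to node `d`, so the copying has not overwritten it.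
      have hs := hI d (by omega) ⟨j, hj⟩ (.inl le_rfl)
      simp only [Expr.eval, Op.apply, Store.setReg_arr, Store.setCell_arr, true_and, h12, h15, h5,
        h10, hn]
      simp only [← Nat.succ_mul, index_inj v.2 hj]
      split_ifs with h
      · obtain ⟨rfl, h⟩ := h
        rw [hs, min_self, min_eq_right (by omega)]
        congr 1
        exact Fin.ext h.symm
      · exact hI d' hd' v (by omega)
  · intro s' hf hI d' hd'
    funext v
    exact hI d' hd' v (.inr (by rw [hn]; exact v.2))

/-- Process the topmost open node of the search tree. -/
def expand (test : Prog) (acc : Expr) : Prog :=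
  .seq (.set 5 (.op .mul (.op .sub (.reg 3) (.const 1)) (.reg 0)))
    (.seq loadSet (.seq (findBad test)
      (.cond (.reg 6)
        (.cond (.cell 1 (.op .add (.reg 5) (.reg 7)))
          (.cond (.cell 1 (.op .add (.reg 5) (.reg 8)))
            (.set 3 (.op .sub (.reg 3) (.const 1)))
            (.store 1 (.op .add (.reg 5) (.reg 8)) (.const 2)))
          (.cond (.cell 1 (.op .add (.reg 5) (.reg 8)))
            (.store 1 (.op .add (.reg 5) (.reg 7)) (.const 2))
            (.seq copyItem
              (.seq (.store 1 (.op .add (.reg 5) (.reg 7)) (.const 2))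
                (.seq (.store 1 (.op .add (.op .add (.reg 5) (.reg 0)) (.reg 7)) (.const 1))
                  (.seq (.store 1 (.op .add (.op .add (.reg 5) (.reg 0)) (.reg 8)) (.const 2))
                    (.set 3 (.op .add (.reg 3) (.const 1)))))))))
        (.seq countSet
          (.seq (.cond acc (.set 4 (.const 1)) .skip)
            (.set 3 (.op .sub (.reg 3) (.const 1))))))))

/-- `S` has no obstruction, and its size is accepted. -/
def Solution (bad : Obstruction) (acc : ℕ → ℕ → ℕ → Prop) {n : ℕ} (G : SimpleGraph (Fin n))
    (t k : ℕ) (S : Finset (Fin n)) : Prop :=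
  (∀ u ∈ S, ∀ v ∈ S, u ≠ v → ¬ bad n G t S u v) ∧ acc t k S.card

/-- The expression `e` tests whether the size in register `13` is accepted. -/
structure IsSizeTest (acc : ℕ → ℕ → ℕ → Prop) (e : Expr) : Prop where
  mono : ∀ t k m m', m ≤ m' → acc t k m → acc t k m'
  small : ∀ B s, 1 ≤ B → e.Small B s
  eval : ∀ s, e.eval s ≠ 0 ↔ acc (s.reg 1) (s.reg 2) (s.reg 13)

/-- Obstructions persist in subsets. -/
def Obstruction.Antitone (bad : Obstruction) : Prop :=
  ∀ n (G : SimpleGraph (Fin n)) t (S S' : Finset (Fin n)) u v, S' ⊆ S → u ∈ S' → v ∈ S' →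
    bad n G t S u v → bad n G t S' u v

/-- The invariant of the search program. -/
structure SearchInv (bad : Obstruction) (acc : ℕ → ℕ → ℕ → Prop) {n : ℕ} (G : SimpleGraph (Fin n))
    (t k M : ℕ) (s : Store) : Prop where
  enc : Enc G t s
  bound : s.reg 2 = k
  search : Search (Solution bad acc G t k) (∃ S, Solution bad acc G t k S) (s.reg 3) (s.reg 4) M
    (item n s)

theorem extends_alive {n : ℕ} (f : Fin n → ℕ) : Extends f (alive f) :=
  ⟨fun v hv => by rw [mem_alive]; omega, Finset.Subset.refl _⟩

/-- The cases are the statuses of an obstructing pair in the topmost node: both kept (`Search.pop`),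
one kept (`Search.replace`), none kept (`Search.branch`). Without an obstruction the node is a leaf,
decided by its size. Every case lowers the potential. -/
theorem expand_spec {bad : Obstruction} {acc : ℕ → ℕ → ℕ → Prop} {test : Prog} {e : Expr}
    (ht : IsTest bad test) (he : IsSizeTest acc e) (hbad : bad.Antitone) {n : ℕ}
    {G : SimpleGraph (Fin n)} {t k M B N : ℕ} {s : Store} (hB : 16 * (n + 2) ^ 2 ≤ B)
    (hN : 2 * n ≤ N) (hI : SearchInv bad acc G t k M s) (hs : s.reg 3 ≠ 0) :
    WP B N (expand test e) (SearchInv bad acc G t k (M - 1)) s := by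
  have hB1 := one_le_of_bound hB
  obtain ⟨d, hd⟩ : ∃ d, s.reg 3 = d + 1 := ⟨s.reg 3 - 1, by omega⟩
  have hS := hI.search
  rw [hd] at hS
  have hdn : d ≤ n := by have := hS.undecided_le d (by omega); omega
  have h0 := hI.enc.size
  refine .seq (.set (by omega) ?_ ?_)
  · have := index_le (d := d) (m := n) (v := 0) hB (by omega) (by omega) (by omega)
    simp [Expr.Small, Expr.eval, Op.apply, hd, h0]; omega
  have hev : Expr.eval s (.op .mul (.op .sub (.reg 3) (.const 1)) (.reg 0)) = d * n := by
    simp [Expr.eval, Op.apply, hd, h0]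
  rw [hev]
  refine .seq ((loadSet_spec (d := d) hB hN (by simpa using h0) (by simp) hdn).mono
    fun s1 hf1 hS1 => ?_)
  rw [item_setReg] at hS1
  have hE1 : Enc G t s1 := hI.enc.of_eq (by rw [hf1.reg 0 rfl]; rfl) (by rw [hf1.reg 1 rfl]; rfl)
    (by rw [hf1.arr 0 rfl]; rfl)
  refine .seq ((findBad_spec ht G t _ hB hN hE1 hS1).mono fun s2 hf2 hF => ?_)
  have hwr : ∀ i < 20, i ≠ 11 → i ≠ 6 → i ≠ 7 → i ≠ 8 → i ≠ 9 → i ≠ 10 →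
      (findBad test).writesReg i = false := by
    intro i hi h1 h2 h3 h4 h5 h6
    simp [findBad, Prog.writesReg, ht.reg i hi h1, *]
  have hwa : ∀ a < 3, (findBad test).writesArr a = false := by
    intro a ha
    simp [findBad, Prog.writesArr, ht.arr a ha]
  have h20 : s2.reg 0 = n := by
    rw [hf2.reg 0 (hwr 0 (by omega) (by omega) (by omega) (by omega) (by omega) (by omega)
      (by omega)), hE1.size]
  have h21 : s2.reg 1 = t := by
    rw [hf2.reg 1 (hwr 1 (by omega) (by omega) (by omega) (by omega) (by omega) (by omega)
      (by omega)), hE1.param]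
  have h22 : s2.reg 2 = k := by
    rw [hf2.reg 2 (hwr 2 (by omega) (by omega) (by omega) (by omega) (by omega) (by omega)
      (by omega)), hf1.reg 2 rfl, ← hI.bound]; rfl
  have h23 : s2.reg 3 = d + 1 := by
    rw [hf2.reg 3 (hwr 3 (by omega) (by omega) (by omega) (by omega) (by omega) (by omega)
      (by omega)), hf1.reg 3 rfl, ← hd]; rfl
  have h24 : s2.reg 4 = s.reg 4 := by
    rw [hf2.reg 4 (hwr 4 (by omega) (by omega) (by omega) (by omega) (by omega) (by omega)
      (by omega)), hf1.reg 4 rfl]; rfl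
  have h25 : s2.reg 5 = d * n := by
    rw [hf2.reg 5 (hwr 5 (by omega) (by omega) (by omega) (by omega) (by omega) (by omega)
      (by omega)), hf1.reg 5 rfl]; simp
  have hE2 : Enc G t s2 := hE1.of_eq (h20.trans hE1.size.symm) (h21.trans hE1.param.symm)
    (hf2.arr 0 (hwa 0 (by omega)))
  have hS2 : EncSet (alive (item n s d)) s2 := hS1.of_eq (hf2.arr 2 (hwa 2 (by omega)))
  have hit : item n s2 = item n s := item_of_eq (by
    rw [hf2.arr 1 (hwa 1 (by omega)), hf1.arr 1 rfl]; rfl)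
  refine .cond (by omega) (by simp [Expr.Small]) (fun h6 => ?_) (fun h6 => ?_)
  · simp only [Expr.eval] at h6
    obtain ⟨u, hu, v, hv, huv, hb, h7, h8⟩ := (hF.resolve_left fun h => h6 h.1).2
    -- The pair obstructs the set of all vertices not deleted, hence also every extension that
    -- contains both of its vertices.
    have hinc : Incompatible (Solution bad acc G t k) (item n s d) u v :=
      fun S hS hsol huS hvS => hsol.1 u huS v hvS huv (hbad n G t _ S u v hS.2 huS hvS hb)
    have iu := index_le (d := d) (m := n) (v := u) hB (by omega) (by omega) (by omega)
    have iv := index_le (d := d) (m := n) (v := v) hB (by omega) (by omega) (by omega)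
    have iu' := index_le (d := d + 1) (m := n) (v := u) hB (by omega) (by omega) (by omega)
    have iv' := index_le (d := d + 1) (m := n) (v := v) hB (by omega) (by omega) (by omega)
    rw [Nat.succ_mul] at iu' iv'
    have hcu : s2.arr 1 (d * n + u) = item n s d u := by rw [← hit]; rfl
    have hcv : s2.arr 1 (d * n + v) = item n s d v := by rw [← hit]; rfl
    rw [mem_alive] at hu hv
    have hle : ∀ (f : Fin n → ℕ) (w : Fin n) (x : ℕ), x ≤ 2 → (∀ y, f y ≤ 2) →
        ∀ y, Function.update f w x y ≤ 2 := by
      intro f w x hx hf y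
      rw [Function.update_apply]; split_ifs; exacts [hx, hf y]
    have hle2 := hS.le_two d (by omega)
    refine .cond (by omega) ?_ (fun hcu' => ?_) (fun hcu' => ?_)
    · simp [Expr.Small, Expr.eval, h25, h7]; omega
    · simp only [Expr.eval, Op.apply, h25, h7, hcu] at hcu'
      refine .cond (by omega) ?_ (fun hcv' => ?_) (fun hcv' => ?_)
      · simp [Expr.Small, Expr.eval, h25, h8]; omega
      · simp only [Expr.eval, Op.apply, h25, h8, hcv] at hcv'
        refine .set (by omega) (by simp [Expr.Small]; omega)
          ⟨hE2.of_eq (by simp) (by simp) rfl, by simpa using h22, ?_⟩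
        simp only [Expr.eval, Op.apply, h23, Store.setReg_reg, h24, Nat.add_sub_cancel]
        refine hS.pop hS.found_le ?_ fun d' _ => ?_
        · have := hinc.not_hasSol (by omega) (by omega)
          simp [this]
        · rw [item_setReg, hit]
      · simp only [Expr.eval, Op.apply, h25, h8, hcv] at hcv'
        refine .store (by omega) ?_ (by simp [Expr.Small]; omega) ⟨hE2.of_eq rfl rfl ?_, h22, ?_⟩
        · simp [Expr.Small, Expr.eval, h25, h8]; omega
        · funext m; simp
        · simp only [Expr.eval, Op.apply, h25, h8, h23, Store.setCell_reg, h24]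
          rw [item_setCell, hit]
          refine hS.replace ?_ ?_ ?_ fun d' hd' => ?_
          · rw [Function.update_self]; exact hinc.hasSol_delete (by omega) hcv'
          · rw [Function.update_self]; exact hle _ _ _ le_rfl hle2
          · rw [Function.update_self]; exact undecided_update hcv' (by omega)
          · rw [Function.update_of_ne (by omega)]
    · simp only [Expr.eval, Op.apply, h25, h7, hcu] at hcu'
      refine .cond (by omega) ?_ (fun hcv' => ?_) (fun hcv' => ?_)
      · simp [Expr.Small, Expr.eval, h25, h8]; omega
      · simp only [Expr.eval, Op.apply, h25, h8, hcv] at hcv'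
        refine .store (by omega) ?_ (by simp [Expr.Small]; omega) ⟨hE2.of_eq rfl rfl ?_, h22, ?_⟩
        · simp [Expr.Small, Expr.eval, h25, h7]; omega
        · funext m; simp
        · simp only [Expr.eval, Op.apply, h25, h7, h23, Store.setCell_reg, h24]
          rw [item_setCell, hit]
          refine hS.replace ?_ ?_ ?_ fun d' hd' => ?_
          · rw [Function.update_self]; exact hinc.symm.hasSol_delete (by omega) hcu'
          · rw [Function.update_self]; exact hle _ _ _ le_rfl hle2
          · rw [Function.update_self]; exact undecided_update hcu' (by omega)
          · rw [Function.update_of_ne (by omega)]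
      · simp only [Expr.eval, Op.apply, h25, h8, hcv] at hcv'
        refine .seq ((copyItem_spec hB hN h20 h25 hdn).mono fun s3 hf3 h3 => ?_)
        have h30 : s3.reg 0 = n := (hf3.reg 0 rfl).trans h20
        have h35 : s3.reg 5 = d * n := (hf3.reg 5 rfl).trans h25
        have h37 : s3.reg 7 = u := (hf3.reg 7 rfl).trans h7
        have h38 : s3.reg 8 = v := (hf3.reg 8 rfl).trans h8
        have h33 : s3.reg 3 = d + 1 := (hf3.reg 3 rfl).trans h23
        have h32 : s3.reg 2 = k := (hf3.reg 2 rfl).trans h22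
        have h34 : s3.reg 4 = s.reg 4 := (hf3.reg 4 rfl).trans h24
        have hE3 : Enc G t s3 := hE2.of_eq (hf3.reg 0 rfl) (hf3.reg 1 rfl) (hf3.arr 0 rfl)
        refine .seq (.store (by omega) ?_ (by simp [Expr.Small]; omega) ?_)
        · simp [Expr.Small, Expr.eval, h35, h37]; omega
        refine .seq (.store (by omega) ?_ (by simp [Expr.Small]; omega) ?_)
        · simp [Expr.Small, Expr.eval, Op.apply, h35, h37, h30]; omega
        refine .seq (.store (by omega) ?_ (by simp [Expr.Small]; omega) ?_)
        · simp [Expr.Small, Expr.eval, Op.apply, h35, h38, h30]; omega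
        have hnB : n + 2 ≤ B := by nlinarith
        refine .set (by omega) ?_ ⟨hE3.of_eq (by simp) (by simp) ?_, by simpa using h32, ?_⟩
        · simp [Expr.Small, Expr.eval, h33]; omega
        · funext m; simp
        · simp only [Expr.eval, Op.apply, h35, h37, h38, h33, h30, Store.setReg_reg,
            Store.setCell_reg, h34]
          rw [item_setReg, show d * n + n = (d + 1) * n by ring]
          rw [item_setCell, item_setCell, item_setCell]
          have e1 : item n s3 d = item n s d := by rw [h3 d (by omega), min_self, hit]
          have e2 : item n s3 (d + 1) = item n s d := by
            rw [h3 _ le_rfl, min_eq_right (by omega), hit]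
          have hv' : Function.update (item n s d) u 1 v = 0 := by
            rw [Function.update_of_ne huv.symm, hcv']
          refine hS.branch ?_ ?_ ?_ ?_ ?_ fun d' hd' => ?_
          · simp only [Function.update_self, Function.update_of_ne (show d ≠ d + 1 by omega),
              Function.update_of_ne (show d + 1 ≠ d by omega), e1, e2]
            exact hinc.hasSol_branch huv hcu' hcv'
          · simp only [Function.update_self, Function.update_of_ne (show d ≠ d + 1 by omega), e1]
            exact hle _ _ _ le_rfl hle2
          · simp only [Function.update_self, Function.update_of_ne (show d + 1 ≠ d by omega), e2]
            exact hle _ _ _ le_rfl (hle _ _ _ (by omega) hle2)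
          · simp only [Function.update_self, Function.update_of_ne (show d ≠ d + 1 by omega), e1]
            exact undecided_update hcu' (by omega)
          · simp only [Function.update_self, Function.update_of_ne (show d + 1 ≠ d by omega), e2]
            have h1 := undecided_update (x := 1) hcu' (by omega)
            have h2 := undecided_update (x := 2) hv' (by omega)
            omega
          · rw [Function.update_of_ne (by omega), Function.update_of_ne (by omega),
              Function.update_of_ne (by omega), h3 d' (by omega), min_eq_left (by omega), hit]
  · simp only [Expr.eval] at h6
    have hno := (hF.resolve_right fun h => by omega).2
    -- Extensions are subsets of the set of vertices not deleted, which is itself free of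
    -- obstructions. As larger sizes are accepted whenever smaller ones are, only this set has to be
    -- tested.
    have hsol : HasSol (Solution bad acc G t k) (item n s d) ↔
        acc t k (alive (item n s d)).card := by
      constructor
      · rintro ⟨S, hS, hsol⟩
        exact he.mono _ _ _ _ (Finset.card_le_card hS.2) hsol.2
      · exact fun h => ⟨_, extends_alive _, fun u hu v hv => hno u hu v hv trivial, h⟩
    refine .seq ((countSet_spec hB hN h20 hS2).mono fun s3 hf3 h3 => ?_)
    have h31 : s3.reg 1 = t := (hf3.reg 1 rfl).trans h21
    have h33 : s3.reg 3 = d + 1 := (hf3.reg 3 rfl).trans h23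
    have h32 : s3.reg 2 = k := (hf3.reg 2 rfl).trans h22
    have h34 : s3.reg 4 = s.reg 4 := (hf3.reg 4 rfl).trans h24
    have hE3 : Enc G t s3 := hE2.of_eq (hf3.reg 0 rfl) (hf3.reg 1 rfl) (hf3.arr 0 rfl)
    have hit3 : item n s3 = item n s := (item_of_eq (hf3.arr 1 rfl)).trans hit
    have hev := he.eval s3
    rw [h31, h32, h3, ← hsol] at hev
    -- The final decrement of the stack pointer, for both outcomes of the size test.
    have fin : ∀ s4 : Store, (∀ i, i ≠ 4 → s4.reg i = s3.reg i) → s4.arr = s3.arr →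
        s4.reg 4 ≤ 1 → (s4.reg 4 = 1 ↔ s.reg 4 = 1 ∨ HasSol (Solution bad acc G t k) (item n s d)) →
        WP B N (.set 3 (.op .sub (.reg 3) (.const 1))) (SearchInv bad acc G t k (M - 1)) s4 := by
      intro s4 hr ha hf hsf
      refine .set (by omega) (by simp [Expr.Small]; omega)
        ⟨hE3.of_eq (by simp [hr]) (by simp [hr]) (by simp [ha]), by simp [hr, h32], ?_⟩
      simp only [Expr.eval, Op.apply, hr 3 (by omega), h33, Store.setReg_reg, Nat.add_sub_cancel]
      refine hS.pop hf hsf fun d' _ => ?_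
      rw [item_of_eq (s := s3) (by simp [ha]), hit3]
    refine .seq (.cond (by omega) (he.small _ _ (by omega)) (fun h => ?_) (fun h => ?_))
    · refine .set (by omega) (by simp [Expr.Small]; omega) (fin _ ?_ rfl ?_ ?_)
      · intro i hi; simp [hi]
      · simp [Expr.eval]
      · simp [Expr.eval, hev.1 h]
    · refine .skip (fin _ (fun _ _ => rfl) rfl (by rw [h34]; exact hS.found_le) ?_)
      rw [h34]
      have : ¬ HasSol (Solution bad acc G t k) (item n s d) := fun hc => hev.2 hc h
      simp [this]

end WordRAM

/-! ### The complete search and its running time -/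

namespace WordRAM

open TwoClub

/-- Decide whether there is a solution, by a search through partial solutions. -/
def solver (test : Prog) (acc : Expr) : Prog :=
  .seq (.set 3 (.const 1)) (.seq (.loop (.reg 3) (expand test acc)) (.set 0 (.reg 4)))

theorem input_enc {n : ℕ} (G : SimpleGraph (Fin n)) (t k : ℕ) : Enc G t (input n G t k) where
  size := rfl
  param := rfl
  adj i j := by
    by_cases hij : G.Adj i j
    · exact (if_pos ⟨rfl, i, j, rfl, hij⟩).trans (if_pos hij).symm
    · refine (if_neg ?_).trans (if_neg hij).symm
      rintro ⟨-, i', j', h, hadj⟩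
      rw [index_inj j.2 j'.2, Fin.val_inj, Fin.val_inj] at h
      exact hij (by rwa [h.1, h.2])

theorem input_bdd {n B : ℕ} (G : SimpleGraph (Fin n)) (t k : ℕ) (hB : 1 ≤ B) (hn : n ≤ B)
    (ht : t ≤ B) (hk : k ≤ B) : (input n G t k).Bdd B := by
  refine ⟨fun i => ?_, fun a j => ?_⟩
  · simp only [input]; split_ifs <;> omega
  · simp only [input]; split_ifs <;> omega

/-- The potential starts at `treeSize n`, from a single node with all vertices undecided, and bounds
the passes of the main loop. Each pass costs `2` for the loop test plus the body; the final `6` is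
the two assignments and the last loop test. -/
theorem solver_decides {Q : Problem} {bad : Obstruction} {acc : ℕ → ℕ → ℕ → Prop} {test : Prog}
    {e : Expr} (ht : IsTest bad test) (he : IsSizeTest acc e) (hbad : bad.Antitone)
    (hQ : ∀ n G t k, Q n G t k ↔ ∃ S, Solution bad acc G t k S) :
    DecidesInTime (solver test e) Q
      (fun n => treeSize n * (2 + (expand test e).time (2 * n)) + 6) := by
  -- The exponent `6` yields `16 * (n + 2) ^ 2 ≤ (n + 2) ^ 6`, because `2 ≤ n + 2`.
  refine ⟨6, fun n G t k => ?_⟩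
  obtain ⟨B, hBe⟩ : ∃ B, B = (n + 2) ^ 6 + t + k := ⟨_, rfl⟩
  rw [← hBe]
  have hB : 16 * (n + 2) ^ 2 ≤ B := by
    have : 2 ^ 4 ≤ (n + 2) ^ 4 := Nat.pow_le_pow_left (by omega) 4
    have : 16 * (n + 2) ^ 2 ≤ (n + 2) ^ 6 := by
      rw [show 6 = 4 + 2 by rfl, pow_add]
      exact Nat.mul_le_mul_right _ this
    omega
  have hB1 := one_le_of_bound hB
  have hnB : n ≤ B := by nlinarith
  have hbd := input_bdd G t k (B := B) (by omega) hnB (by omega) (by omega)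
  have hI : SearchInv bad acc G t k (treeSize n) ((input n G t k).setReg 3 1) := by
    refine ⟨(input_enc G t k).of_eq rfl rfl rfl, rfl, ?_⟩
    have hit : item n ((input n G t k).setReg 3 1) 0 = fun _ => 0 := by
      funext v; simp [item, input]
    have h3 : ((input n G t k).setReg 3 1).reg 3 = 1 := by simp
    have h4 : ((input n G t k).setReg 3 1).reg 4 = 0 := by simp [input]
    have hu : undecided (fun _ : Fin n => 0) = n := by simp [undecided]
    rw [h3, h4]
    refine ⟨?_, ?_, by omega, ?_, ?_⟩
    · intro d hd
      obtain rfl : d = 0 := by omega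
      rw [hit, hu]; omega
    · intro d hd v
      obtain rfl : d = 0 := by omega
      simp [hit]
    · simp [hit, HasSol, Extends, alive, Finset.subset_iff]
    · simp [hit, hu]
  obtain ⟨τ, s', hx, hτ, hb', hz, M', hI'⟩ := WP.loop_aux (B := B) (N := 2 * n) (e := .reg 3)
    (p := expand test e) (by omega) (fun M s => SearchInv bad acc G t k M s)
    (fun _ _ _ => by simp [Expr.Small]) (fun M s h hne => by
      simp only [Expr.eval] at hne
      have hM : 1 ≤ M := by
        have := h.search
        rw [show s.reg 3 = s.reg 3 - 1 + 1 by omega] at this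
        exact this.pos
      exact ⟨M - 1, by omega, expand_spec ht he hbad hB le_rfl h hne⟩)
    _ _ hI (hbd.setReg (by omega) 3)
  simp only [Expr.eval] at hz
  refine ⟨_, _, .seq (.set _ 3 (.const 1) (by simp only [Expr.Fits]; omega))
    (.seq hx (.set _ 0 (.reg 4) (hb'.1 4))), ?_, ?_⟩
  · simp only [Expr.cost, Nat.reduceAdd] at hτ ⊢
    omega
  · have h1 := hI'.search.iff
    have h2 := hI'.search.found_le
    -- With an empty stack, the invariant says that `found` is the answer.
    rw [hz, ← hQ] at h1
    simp only [Expr.eval, Function.update_self]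
    by_cases hq : Q n G t k
    · simp only [hq, not_lt_zero, false_and, exists_false, or_false, iff_true] at h1
      simp [hq, h1]
    · simp only [hq, not_lt_zero, false_and, exists_false, or_false, iff_false] at h1
      simp only [hq, if_false]; omega

-- A polynomial times `1.619 ^ n` is `o(1.62 ^ n)`.
open Asymptotics Filter in
theorem treeSize_mul_time_isBigO (p : Prog) :
    (fun n => ((treeSize n * (2 + p.time (2 * n)) + 6 : ℕ) : ℝ)) =O[atTop]
      (fun n => (1.62 : ℝ) ^ n) := by
  obtain ⟨C, d, hC⟩ := p.time_le_pow
  have h1 : (fun n : ℕ => (n : ℝ) ^ d * (1.619 : ℝ) ^ n) =O[atTop] (fun n => (1.62 : ℝ) ^ n) :=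
    (isLittleO_pow_const_mul_const_pow_const_pow_of_norm_lt d
      (by rw [Real.norm_eq_abs, abs_of_pos] <;> norm_num)).isBigO
  -- Here `3` comes from `treeSize_le`, `C + 8` from `C` and the summands `2` and `6`, and `3 ^ d`
  -- from `2 * n + 1 ≤ 3 * n` for `n ≥ 1`.
  refine IsBigO.trans (IsBigO.of_bound ((3 * (C + 8) * 3 ^ d : ℕ) : ℝ) ?_) h1
  filter_upwards [eventually_ge_atTop 1] with n hn
  rw [Real.norm_of_nonneg (by positivity), Real.norm_of_nonneg (by positivity)]
  have h2 : treeSize n * (2 + p.time (2 * n)) + 6 ≤ treeSize n * ((C + 8) * (3 * n) ^ d) := by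
    have h3 := hC (2 * n)
    have h4 : (2 * n + 1) ^ d ≤ (3 * n) ^ d := Nat.pow_le_pow_left (by omega) d
    have h5 : 1 ≤ (3 * n) ^ d := Nat.one_le_pow _ _ (by omega)
    have h6 := treeSize_pos n
    calc treeSize n * (2 + p.time (2 * n)) + 6
        ≤ treeSize n * (2 + p.time (2 * n)) + treeSize n * 6 := by omega
      _ = treeSize n * (8 + p.time (2 * n)) := by ring
      _ ≤ treeSize n * (8 * (3 * n) ^ d + C * (3 * n) ^ d) := by
        refine Nat.mul_le_mul_left _ (add_le_add (by omega) (h3.trans ?_))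
        exact Nat.mul_le_mul_left _ h4
      _ = _ := by ring
  have h3 := treeSize_le n
  calc ((treeSize n * (2 + p.time (2 * n)) + 6 : ℕ) : ℝ)
      ≤ ((treeSize n * ((C + 8) * (3 * n) ^ d) : ℕ) : ℝ) := by exact_mod_cast h2
    _ = (treeSize n : ℝ) * ((C + 8) * (3 * n) ^ d) := by push_cast; ring
    _ ≤ (3 * 1.619 ^ n) * ((C + 8) * (3 * n) ^ d) := by
        gcongr; linarith
    _ = _ := by push_cast; ring

/-- Reduces each problem to a test program for an antitone obstruction, a monotone size test, and a
description of its solutions by the two. -/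
theorem solvableInTimeO {Q : Problem} {bad : Obstruction} {acc : ℕ → ℕ → ℕ → Prop} {test : Prog}
    {e : Expr} (ht : IsTest bad test) (he : IsSizeTest acc e) (hbad : bad.Antitone)
    (hQ : ∀ n G t k, Q n G t k ↔ ∃ S, Solution bad acc G t k S) :
    SolvableInTimeO Q (fun n => (1.62 : ℝ) ^ n) :=
  ⟨_, _, solver_decides ht he hbad hQ, treeSize_mul_time_isBigO _⟩

end WordRAM

/-! ## Robust and hereditary 2-clubs -/

namespace WordRAM

open TwoClub

open Classical in
/-- The number of common neighbors of `u` and `v` in `S`. -/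
noncomputable def common {n : ℕ} (G : SimpleGraph (Fin n)) (S : Finset (Fin n)) (u v : Fin n) : ℕ :=
  (S.filter fun w => G.Adj u w ∧ G.Adj w v).card

theorem common_eq {n : ℕ} (G : SimpleGraph (Fin n)) (S : Finset (Fin n)) (u v : Fin n)
    [DecidablePred fun w => G.Adj u w ∧ G.Adj w v] :
    common G S u v = (S.filter fun w => G.Adj u w ∧ G.Adj w v).card := by
  unfold common
  congr!

/-- The entry of the adjacency matrix for the vertices in registers `i` and `j`. -/
def adjExpr (i j : ℕ) : Expr := .cell 0 (.op .add (.op .mul (.reg i) (.reg 0)) (.reg j))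

theorem adjExpr_small {n B : ℕ} {s : Store} {i j : ℕ} (hB : 16 * (n + 2) ^ 2 ≤ B)
    (hn : s.reg 0 = n) (hi : s.reg i < n) (hj : s.reg j < n) : (adjExpr i j).Small B s := by
  have h := index_le (d := s.reg i) (m := n) (v := s.reg j) hB (by omega) (by omega) (by omega)
  simp [adjExpr, Expr.Small, Expr.eval, Op.apply, hn]
  omega

open Classical in
theorem adjExpr_eval {n t : ℕ} {G : SimpleGraph (Fin n)} {s : Store} (hE : Enc G t s) {i j : ℕ}
    {u v : Fin n} (hi : s.reg i = u) (hj : s.reg j = v) :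
    (adjExpr i j).eval s = if G.Adj u v then 1 else 0 := by
  rw [← hE.adj u v]
  simp [adjExpr, Expr.eval, Op.apply, hE.size, hi, hj]

/-- Put the number of common neighbors of the vertices in registers `9` and `10` into
register `21`. -/
def countCommon : Prog :=
  .seq (.set 21 (.const 0)) (forLoop 20 0 (.set 21 (.op .add (.reg 21)
    (.op .mul (.cell 2 (.reg 20)) (.op .mul (adjExpr 9 20) (adjExpr 20 10))))))

theorem countCommon_spec {n t B N : ℕ} {G : SimpleGraph (Fin n)} {s : Store} {S : Finset (Fin n)}
    {u v : Fin n} (hB : 16 * (n + 2) ^ 2 ≤ B) (hN : 2 * n ≤ N) (hE : Enc G t s) (hS : EncSet S s)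
    (hu : s.reg 9 = u) (hv : s.reg 10 = v) :
    WP B N countCommon (fun s' => s'.reg 21 = common G S u v) s := by
  classical
  have hB1 := one_le_of_bound hB
  have hn := hE.size
  -- The indicator of the common neighbors, extended by zero to all numbers so that the loop
  -- invariant can be a sum over `Finset.range`.
  obtain ⟨c, hc⟩ : ∃ c : ℕ → ℕ, ∀ w : Fin n, c w = if w ∈ S ∧ G.Adj u w ∧ G.Adj w v then 1 else 0 :=
    ⟨fun w => if h : w < n then if (⟨w, h⟩ : Fin n) ∈ S ∧ G.Adj u ⟨w, h⟩ ∧ G.Adj ⟨w, h⟩ v then 1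
      else 0 else 0, fun w => by simp⟩
  refine .seq (.set (by omega) (by simp [Expr.Small]) ?_)
  refine .forLoop (fun j s' => s'.reg 21 = ∑ w ∈ Finset.range j, c w) (by omega) (by omega)
    rfl rfl (by simp; omega) (by simp [Expr.eval]) ?_ ?_
  · intro j hj s1 hf h20 hI
    replace hj : j < n := by simpa [hn] using hj
    have hE1 : Enc G t s1 := hE.of_eq ((hf.reg 0 rfl).trans (by simp))
      ((hf.reg 1 rfl).trans (by simp)) ((hf.arr 0 rfl).trans rfl)
    have hS1 : EncSet S s1 := hS.of_eq (hf.arr 2 rfl)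
    have h9 : s1.reg 9 = u := (hf.reg 9 rfl).trans (by simpa using hu)
    have h10 : s1.reg 10 = v := (hf.reg 10 rfl).trans (by simpa using hv)
    have hle : ∀ w ∈ Finset.range (j + 1), c w ≤ 1 := by
      intro w hw
      rw [Finset.mem_range] at hw
      have := hc ⟨w, by omega⟩
      simp only at this
      rw [this]; split_ifs <;> omega
    have hsum := Finset.sum_le_card_nsmul _ _ _ hle
    rw [Finset.card_range, Finset.sum_range_succ, smul_eq_mul, mul_one] at hsum
    have e1 := adjExpr_eval hE1 h9 (j := 20) (v := ⟨j, hj⟩) h20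
    have e2 := adjExpr_eval hE1 (i := 20) (u := ⟨j, hj⟩) h20 h10
    have e3 := hS1 ⟨j, hj⟩
    have e4 := hc ⟨j, hj⟩
    simp only at e3 e4
    -- All three factors are `0` or `1`, so their product is a conjunction.
    have key : s1.arr 2 j * ((adjExpr 9 20).eval s1 * (adjExpr 20 10).eval s1) = c j := by
      rw [e1, e2, e3, e4]
      by_cases a1 : (⟨j, hj⟩ : Fin n) ∈ S <;> by_cases a2 : G.Adj u ⟨j, hj⟩ <;>
        by_cases a3 : G.Adj ⟨j, hj⟩ v <;> simp [a1, a2, a3]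
    have k2 : (adjExpr 9 20).eval s1 * (adjExpr 20 10).eval s1 ≤ 1 := by
      rw [e1, e2]; split_ifs <;> omega
    have : n ≤ B := by nlinarith
    have hcj := hle j (by simp)
    refine .set (by omega) ?_ ?_
    · simp only [Expr.Small, Expr.eval, Op.apply, h20, true_and]
      rw [key]
      exact ⟨⟨⟨adjExpr_small hB hE1.size (by omega) (by omega),
        adjExpr_small hB hE1.size (by omega) (by omega), by omega⟩, by omega⟩, by omega⟩
    · simp [Expr.eval, Op.apply, h20, key, hI, Finset.sum_range_succ]
  · intro s' hf hI
    have h0 : (s.setReg 21 (Expr.eval s (.const 0))).reg 0 = n := by simpa using hn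
    rw [h0, Finset.sum_range] at hI
    simp only [hI, hc, common, Finset.sum_boole, Nat.cast_id]
    congr 1
    ext w
    simp

open Classical in
/-- The vertices `u` and `v` are connected by fewer than `t` disjoint paths of length at
most two. -/
noncomputable def robustBad : Obstruction := fun _ G t S u v =>
  common G S u v + (if G.Adj u v then 1 else 0) < t

/-- The vertices `u` and `v` have distance more than two after the deletion of `t` vertices. -/
noncomputable def hereditaryBad : Obstruction := fun _ G t S u v =>
  ¬ G.Adj u v ∧ common G S u v ≤ t

def robustTest : Prog :=
  .seq countCommon (.set 11 (.op .lt (.op .add (.reg 21) (adjExpr 9 10)) (.reg 1)))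

/-- On the values `0` and `1`, the term `1 - x` is negation and multiplication is conjunction. -/
def hereditaryTest : Prog :=
  .seq countCommon (.set 11 (.op .mul (.op .sub (.const 1) (adjExpr 9 10))
    (.op .sub (.const 1) (.op .lt (.reg 1) (.reg 21)))))

theorem common_le {n : ℕ} (G : SimpleGraph (Fin n)) (S : Finset (Fin n)) (u v : Fin n) :
    common G S u v ≤ n :=
  (Finset.card_le_univ _).trans (by simp)

theorem common_mono {n : ℕ} (G : SimpleGraph (Fin n)) {S S' : Finset (Fin n)} (h : S' ⊆ S)
    (u v : Fin n) : common G S' u v ≤ common G S u v := by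
  classical
  exact Finset.card_le_card (Finset.filter_subset_filter _ h)

theorem robustTest_isTest : IsTest robustBad robustTest where
  reg := by decide
  arr := by decide
  correct := by
    intro n G t S B N s u v hB hN hE hS h9 h10 hu hv huv
    have hB1 := one_le_of_bound hB
    refine .seq ((countCommon_spec hB hN hE hS h9 h10).mono fun s1 hf h21 => ?_)
    have hE1 : Enc G t s1 := hE.of_eq (hf.reg 0 rfl) (hf.reg 1 rfl) (hf.arr 0 rfl)
    have h19 : s1.reg 9 = u := (hf.reg 9 rfl).trans h9
    have h110 : s1.reg 10 = v := (hf.reg 10 rfl).trans h10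
    have ha := adjExpr_eval hE1 h19 h110
    have := common_le G S u v
    have : n + 1 ≤ B := by nlinarith
    refine .set (by omega) ?_ ?_
    · simp only [Expr.Small, Expr.eval, ha, h21, true_and, and_true]
      exact ⟨adjExpr_small hB hE1.size (by omega) (by omega), by split_ifs <;> omega⟩
    · simp only [Expr.eval, Op.apply, ha, h21, hE1.param, Store.setReg_reg, if_true]
      by_cases h : robustBad n G t S u v
      · rw [if_pos h]; exact if_pos h
      · rw [if_neg h]; exact if_neg h

theorem hereditaryTest_isTest : IsTest hereditaryBad hereditaryTest where
  reg := by decide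
  arr := by decide
  correct := by
    intro n G t S B N s u v hB hN hE hS h9 h10 hu hv huv
    have hB1 := one_le_of_bound hB
    refine .seq ((countCommon_spec hB hN hE hS h9 h10).mono fun s1 hf h21 => ?_)
    have hE1 : Enc G t s1 := hE.of_eq (hf.reg 0 rfl) (hf.reg 1 rfl) (hf.arr 0 rfl)
    have h19 : s1.reg 9 = u := (hf.reg 9 rfl).trans h9
    have h110 : s1.reg 10 = v := (hf.reg 10 rfl).trans h10
    have ha := adjExpr_eval hE1 h19 h110
    refine .set (by omega) ?_ ?_
    · simp only [Expr.Small, Expr.eval, Op.apply, ha, h21, and_true]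
      refine ⟨⟨by omega, adjExpr_small hB hE1.size (by omega) (by omega)⟩, by omega, ?_⟩
      split_ifs <;> omega
    · simp only [Expr.eval, Op.apply, ha, h21, hE1.param, hereditaryBad, Store.setReg_reg, if_true]
      by_cases h1 : G.Adj u v <;> by_cases h2 : t < common G S u v <;> simp [h1, h2]

theorem robustBad_antitone : Obstruction.Antitone robustBad := by
  intro n G t S S' u v h _ _ hb
  have := common_mono G h u v
  simp only [robustBad] at hb ⊢
  omega

theorem hereditaryBad_antitone : Obstruction.Antitone hereditaryBad := by
  intro n G t S S' u v h _ _ hb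
  exact ⟨hb.1, (common_mono G h u v).trans hb.2⟩

/-- Accept sets of at least `k` vertices. -/
def sizeExpr : Expr := .op .sub (.const 1) (.op .lt (.reg 13) (.reg 2))

theorem sizeExpr_isSizeTest : IsSizeTest (fun _ k m => k ≤ m) sizeExpr where
  mono _ _ _ _ h h' := h'.trans h
  small B s hB := by simpa [sizeExpr, Expr.Small] using hB
  eval s := by
    by_cases h : s.reg 13 < s.reg 2
    · simp [sizeExpr, Expr.eval, Op.apply, h]
    · simp [sizeExpr, Expr.eval, Op.apply, h]; omega

end WordRAM

/-! ### Robust and hereditary 2-clubs in terms of pairs of vertices -/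

namespace TwoClub

open WordRAM

variable {n : ℕ} {G : SimpleGraph (Fin n)} {t : ℕ} {S : Finset (Fin n)}

/-- A distance exceeds two exactly if the vertices are distinct, nonadjacent and without a common
neighbor. -/
theorem isTwoClub_iff {V : Type*} {G : SimpleGraph V} {S : Set V} :
    IsTwoClub G S ↔ ∀ u ∈ S, ∀ v ∈ S, u ≠ v → ¬ G.Adj u v → ∃ w ∈ S, G.Adj u w ∧ G.Adj w v := by
  rw [IsTwoClub, SimpleGraph.ediam_le_iff]
  simp only [← not_lt, SimpleGraph.two_lt_edist_iff]
  constructor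
  · intro h u hu v hv huv hadj
    by_contra hc
    push Not at hc
    refine h ⟨u, hu⟩ ⟨v, hv⟩ ⟨by simpa using huv, hadj, Set.eq_empty_of_forall_notMem fun w hw => ?_⟩
    rw [SimpleGraph.mem_commonNeighbors] at hw
    exact hc w w.2 hw.1 hw.2.symm
  · rintro h ⟨u, hu⟩ ⟨v, hv⟩ ⟨huv, hadj, he⟩
    obtain ⟨w, hw, h1, h2⟩ := h u hu v hv (by simpa using huv) (by simpa using hadj)
    have : (⟨w, hw⟩ : S) ∈ (G.induce S).commonNeighbors ⟨u, hu⟩ ⟨v, hv⟩ := by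
      rw [SimpleGraph.mem_commonNeighbors]
      exact ⟨h1, h2.symm⟩
    rw [he] at this
    exact this

/-- To push two nonadjacent vertices to a distance above two, one has to delete all their common
neighbors, and this suffices. -/
theorem isHereditary_iff : IsHereditary t G S ↔
    ∀ u ∈ S, ∀ v ∈ S, u ≠ v → ¬ hereditaryBad n G t S u v := by
  classical
  constructor
  · rintro h u hu v hv huv ⟨hadj, hc⟩
    have := h (S.filter fun w => G.Adj u w ∧ G.Adj w v) (Finset.filter_subset _ _)
      ((common_eq G S u v).symm.trans_le hc)
    rw [isTwoClub_iff] at this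
    obtain ⟨w, hw, h1, h2⟩ := this u (by simp [hu]) v (by simp [hv]) huv hadj
    simp [h1, h2] at hw
  · intro h U hU hUt
    rw [isTwoClub_iff]
    intro u hu v hv huv hadj
    by_contra hc
    push Not at hc
    refine h u (by simpa using hu.1) v (by simpa using hv.1) huv ⟨hadj, le_trans ?_ hUt⟩
    refine Finset.card_le_card fun w hw => ?_
    rw [Finset.mem_filter] at hw
    by_contra hwU
    exact hc w ⟨by simpa using hw.1, by simpa using hwU⟩ hw.2.1 hw.2.2

/-- The path `u, w, v`, or the edge from `u` to `v` if `w = v`. -/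
theorem exists_path_through {V : Type*} {G : SimpleGraph V} {u v w : V} (huv : u ≠ v)
    (h : G.Adj u w) (h' : w = v ∨ G.Adj w v) :
    ∃ p : G.Path u v, p.1.length ≤ 2 ∧ p.1.getVert 1 = w ∧
      ∀ x ∈ p.1.support, x = u ∨ x = v ∨ x = w := by
  by_cases hw : w = v
  · subst hw
    exact ⟨⟨.cons h .nil, by simp [SimpleGraph.Walk.isPath_def, huv]⟩, by simp, by simp, by simp⟩
  · replace h' := h'.resolve_left hw
    refine ⟨⟨.cons h (.cons h' .nil), ?_⟩, by simp, by simp, by simp⟩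
    simp [SimpleGraph.Walk.isPath_def, huv, h.ne, hw]

/-- Between distinct vertices, a path of length at most two is a single edge if its second vertex is
`v`, and otherwise goes through that vertex directly to `v`. -/
theorem getVert_one_injOn {V : Type*} {G : SimpleGraph V} {u v : V} (huv : u ≠ v) :
    Set.InjOn (fun p : G.Path u v => p.1.getVert 1) {p | p.1.length ≤ 2} := by
  rintro ⟨p, hp⟩ h2 ⟨q, hq⟩ h2' h
  simp only [Set.mem_ofPred_eq] at h2 h2' h
  rcases p with _ | ⟨ha, _ | ⟨hb, _ | ⟨hc, p⟩⟩⟩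
  · exact absurd rfl huv
  · rcases q with _ | ⟨ha', _ | ⟨hb', _ | ⟨hc', q⟩⟩⟩
    · exact absurd rfl huv
    · rfl
    · simp only [SimpleGraph.Walk.getVert_cons_succ, SimpleGraph.Walk.getVert_zero] at h
      exact absurd h.symm hb'.ne
    · simp at h2'
  · rcases q with _ | ⟨ha', _ | ⟨hb', _ | ⟨hc', q⟩⟩⟩
    · exact absurd rfl huv
    · simp only [SimpleGraph.Walk.getVert_cons_succ, SimpleGraph.Walk.getVert_zero] at h
      exact absurd h hb.ne
    · simp only [SimpleGraph.Walk.getVert_cons_succ, SimpleGraph.Walk.getVert_zero] at h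
      subst h; rfl
    · simp at h2'
  · simp at h2

/-- Paths of length at most two correspond to their second vertices: the neighbors `w` of `u` in `S`
with `w = v` or `w` adjacent to `v`. Different choices of `w` give internally disjoint paths. -/
theorem isRobust_iff : IsRobust t G S ↔
    ∀ u ∈ S, ∀ v ∈ S, u ≠ v → ¬ robustBad n G t S u v := by
  classical
  -- The edge from `u` to `v` accounts for `w = v`, which is not among the common neighbors since
  -- `v` is not adjacent to itself.
  have hcard : ∀ u v : Fin n, u ∈ S → v ∈ S →
      common G S u v + (if G.Adj u v then 1 else 0) =
        (S.filter fun w => G.Adj u w ∧ (w = v ∨ G.Adj w v)).card := by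
    intro u v hu hv
    have : (S.filter fun w => G.Adj u w ∧ (w = v ∨ G.Adj w v)) =
        (S.filter fun w => G.Adj u w ∧ G.Adj w v) ∪ (if G.Adj u v then {v} else ∅) := by
      ext w
      split_ifs with h
      · simp only [Finset.mem_filter, Finset.mem_union, Finset.mem_singleton]
        constructor
        · tauto
        · rintro (h' | rfl)
          exacts [⟨h'.1, h'.2.1, .inr h'.2.2⟩, ⟨hv, h, .inl rfl⟩]
      · simp only [Finset.mem_filter, Finset.union_empty]
        constructor
        · rintro ⟨h1, h2, rfl | h3⟩
          exacts [absurd h2 h, ⟨h1, h2, h3⟩]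
        · tauto
    rw [this, Finset.card_union_of_disjoint]
    · congr 1
      split_ifs <;> simp
    · split_ifs <;> simp
  have hbad : ∀ u v : Fin n, robustBad n G t S u v ↔
      common G S u v + (if G.Adj u v then 1 else 0) < t := by
    intro u v
    unfold robustBad
    by_cases h : G.Adj u v <;> simp [h]
  constructor
  · intro h u hu v hv huv
    rw [hbad, hcard u v hu hv, not_lt]
    obtain ⟨P, hP, hlen, -⟩ := h ⟨u, by simpa using hu⟩ ⟨v, by simpa using hv⟩ (by simpa using huv)
    rw [← hP]
    refine Finset.card_le_card_of_injOn (fun p => (p.1.getVert 1).1) ?_ ?_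
    · intro p hp
      have hl := hlen p hp
      have hadj : ∀ i < p.1.length, G.Adj (p.1.getVert i).1 (p.1.getVert (i + 1)).1 :=
        fun i hi => p.1.adj_getVert_succ hi
      have hend := p.1.getVert_length
      have h0 : p.1.length ≠ 0 := by
        intro h0
        have := SimpleGraph.Walk.eq_of_length_eq_zero h0
        simp at this
        exact huv this
      have h1 := hadj 0 (by omega)
      rw [SimpleGraph.Walk.getVert_zero] at h1
      simp only [Finset.coe_filter, Set.mem_ofPred_eq]
      refine ⟨by simp, h1, ?_⟩
      rcases (by omega : p.1.length = 1 ∨ p.1.length = 2) with hl1 | hl2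
      · rw [hl1] at hend; left; rw [hend]
      · right
        have := hadj 1 (by omega)
        rw [hl2] at hend
        rwa [show 1 + 1 = 2 from rfl, hend] at this
    · intro p hp q hq hpq
      exact getVert_one_injOn (by simpa using huv) (hlen p hp) (hlen q hq) (Subtype.ext hpq)
  · intro h u v huv
    have hu : u.1 ∈ S := by simp
    have hv : v.1 ∈ S := by simp
    have huv' : u.1 ≠ v.1 := fun h => huv (Subtype.ext h)
    have := h u hu v hv huv'
    rw [hbad, hcard u v hu hv, not_lt] at this
    obtain ⟨W, hW, hWt⟩ := Finset.exists_subset_card_eq this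
    have hp : ∀ w : W, ∃ p : (G.induce (S : Set (Fin n))).Path u v, p.1.length ≤ 2 ∧
        (p.1.getVert 1).1 = w.1 ∧ ∀ x ∈ p.1.support, x = u ∨ x = v ∨ x.1 = w := by
      rintro ⟨w, hw⟩
      have hw' := Finset.mem_filter.1 (hW hw)
      obtain ⟨p, h1, h2, h3⟩ := exists_path_through (G := G.induce (S : Set (Fin n))) (u := u)
        (v := v) (w := ⟨w, by simpa using hw'.1⟩) huv hw'.2.1
        (hw'.2.2.imp (fun h => Subtype.ext h) id)
      refine ⟨p, h1, by rw [h2], fun x hx => (h3 x hx).imp_right (Or.imp_right fun h => by rw [h])⟩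
    choose p hp1 hp2 hp3 using hp
    have hinj : Function.Injective p := fun a b hab => Subtype.ext (by
      rw [← hp2 a, ← hp2 b, hab])
    refine ⟨Finset.univ.map ⟨p, hinj⟩, by simp [hWt], ?_, ?_⟩
    · intro q hq
      obtain ⟨w, -, rfl⟩ := Finset.mem_map.1 hq
      exact hp1 w
    · intro q hq q' hq' hne x hx hx'
      obtain ⟨w, -, rfl⟩ := Finset.mem_map.1 hq
      obtain ⟨w', -, rfl⟩ := Finset.mem_map.1 hq'
      rcases hp3 w x hx with h | h | h
      · exact .inl h
      · exact .inr h
      rcases hp3 w' x hx' with h' | h' | h'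
      · exact .inl h'
      · exact .inr h'
      exact absurd (congrArg p (Subtype.ext (h.symm.trans h'))) hne

end TwoClub

namespace WordRAM

open TwoClub

theorem robustTwoClub_solvable : SolvableInTimeO RobustTwoClub (fun n => (1.62 : ℝ) ^ n) :=
  solvableInTimeO robustTest_isTest sizeExpr_isSizeTest robustBad_antitone fun _ _ _ _ =>
    exists_congr fun _ => and_congr_left fun _ => isRobust_iff

theorem hereditaryTwoClub_solvable : SolvableInTimeO HereditaryTwoClub (fun n => (1.62 : ℝ) ^ n) :=
  solvableInTimeO hereditaryTest_isTest sizeExpr_isSizeTest hereditaryBad_antitone fun _ _ _ _ =>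
    exists_congr fun _ => and_congr_left fun _ => isHereditary_iff

end WordRAM

/-! ## Minimum cuts by augmenting paths -/

namespace TwoClub

open Finset

/-- The capacity of the arcs that leave `X`, in a network with nodes `0, …, N - 1`. -/
def cut (N : ℕ) (R : ℕ → ℕ → ℕ) (X : Finset ℕ) : ℕ :=
  ∑ a ∈ range N, ∑ b ∈ range N, if a ∈ X ∧ b ∉ X then R a b else 0

theorem cut_congr {N : ℕ} {R R' : ℕ → ℕ → ℕ} (h : ∀ a < N, ∀ b < N, R a b = R' a b)
    (X : Finset ℕ) : cut N R X = cut N R' X :=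
  sum_congr rfl fun a ha => sum_congr rfl fun b hb => by
    rw [h a (mem_range.1 ha) b (mem_range.1 hb)]

/-- The capacity of a cut is linear in the network, so one more unit on an arc affects precisely the
cuts that this arc leaves. -/
theorem cut_add_one {N : ℕ} {R R' : ℕ → ℕ → ℕ} {x y : ℕ} (hx : x < N) (hy : y < N)
    (h : ∀ a < N, ∀ b < N, R' a b = R a b + if a = x ∧ b = y then 1 else 0) (X : Finset ℕ) :
    cut N R' X = cut N R X + if x ∈ X ∧ y ∉ X then 1 else 0 := by
  have : ∀ a ∈ range N, ∀ b ∈ range N, (if a ∈ X ∧ b ∉ X then R' a b else 0) =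
      (if a ∈ X ∧ b ∉ X then R a b else 0) +
        if a = x then if b = y then if x ∈ X ∧ y ∉ X then 1 else 0 else 0 else 0 := by
    intro a ha b hb
    rw [h a (mem_range.1 ha) b (mem_range.1 hb)]
    by_cases h1 : a = x <;> by_cases h2 : b = y
    · subst h1 h2
      split_ifs <;> simp_all
    all_goals simp [h1, h2]
  rw [cut, sum_congr rfl fun a ha => sum_congr rfl (this a ha)]
  simp only [sum_add_distrib, cut]
  congr 1
  rw [sum_eq_single_of_mem x (mem_range.2 hx) fun a _ hne => by simp [hne],
    sum_eq_single_of_mem y (mem_range.2 hy) fun a _ hne => by simp [hne]]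
  simp

/-- The effect of the reversal of an arc from `y` to `x`. -/
theorem cut_reverse {N : ℕ} {R R' : ℕ → ℕ → ℕ} {x y : ℕ} (hx : x < N) (hy : y < N) (hxy : x ≠ y)
    (hR : 0 < R y x) (h1 : R' y x + 1 = R y x) (h2 : R' x y = R x y + 1)
    (h : ∀ a < N, ∀ b < N, ¬ (a = y ∧ b = x) → ¬ (a = x ∧ b = y) → R' a b = R a b)
    (X : Finset ℕ) :
    cut N R' X + (if y ∈ X then 1 else 0) = cut N R X + (if x ∈ X then 1 else 0) := by
  -- The network after lowering the arc from `y` to `x` and before raising the opposite one: both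
  -- `R` and `R'` arise from it by adding one unit to one arc.
  obtain ⟨Q, hQ⟩ : ∃ Q : ℕ → ℕ → ℕ, ∀ a b, Q a b = if a = y ∧ b = x then R a b - 1 else R a b :=
    ⟨_, fun _ _ => rfl⟩
  have e1 := cut_add_one (R := Q) (R' := R) hy hx (fun a ha b hb => by
    rw [hQ]; split_ifs with h
    · rw [h.1, h.2]; omega
    · rfl) X
  have e2 := cut_add_one (R := Q) (R' := R') hx hy (fun a ha b hb => by
    rw [hQ]
    by_cases h3 : a = y ∧ b = x
    · rw [if_pos h3, if_neg (by omega), h3.1, h3.2]; omega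
    · by_cases h4 : a = x ∧ b = y
      · rw [if_neg h3, if_pos h4, h4.1, h4.2, h2]
      · rw [if_neg h3, if_neg h4, h a ha b hb h3 h4, add_zero]) X
  rw [e1, e2]
  by_cases a : x ∈ X <;> by_cases b : y ∈ X <;> simp [a, b]

/-- A tree of paths from `src` in the network: the nodes `b` with `dep b ≠ 0` belong to it, and
`par b` is the predecessor of `b`. -/
structure PathTree (N src : ℕ) (R : ℕ → ℕ → ℕ) (dep par : ℕ → ℕ) : Prop where
  root : dep src = 1
  pred : ∀ b < N, dep b ≠ 0 → b = src ∨
    (par b < N ∧ dep (par b) ≠ 0 ∧ dep b = dep (par b) + 1 ∧ 0 < R (par b) b)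

namespace PathTree

variable {N src : ℕ} {R : ℕ → ℕ → ℕ} {dep par : ℕ → ℕ}

theorem exists_dep_eq (h : PathTree N src R dep par) (hs : src < N) (d : ℕ) :
    ∀ b < N, dep b = d + 1 → ∀ e ≤ d, ∃ b' < N, dep b' = e + 1 := by
  induction d with
  | zero => exact fun b hb hd e he => ⟨b, hb, by omega⟩
  | succ d ih =>
    intro b hb hd e he
    rcases Nat.lt_or_ge d e with h' | h'
    · exact ⟨b, hb, by omega⟩
    · rcases h.pred b hb (by omega) with rfl | ⟨h1, h2, h3, h4⟩
      · have := h.root; omega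
      · exact ih _ h1 (by omega) e h'

/-- Following predecessors, all depths from `1` to `dep b` occur at nodes of the network, so there
are at most `N` of them. -/
theorem dep_le (h : PathTree N src R dep par) (hs : src < N) {b : ℕ} (hb : b < N) : dep b ≤ N := by
  rcases Nat.eq_zero_or_pos (dep b) with h0 | h0
  · omega
  have hsub : (range (dep b)).image (· + 1) ⊆ (range N).image dep := by
    intro m hm
    obtain ⟨e, he, rfl⟩ := mem_image.1 hm
    rw [mem_range] at he
    obtain ⟨b', hb', hd⟩ := h.exists_dep_eq hs (dep b - 1) b hb (by omega) e (by omega)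
    exact mem_image.2 ⟨b', mem_range.2 hb', hd⟩
  have h1 := card_le_card hsub
  rw [card_image_of_injective _ (add_left_injective 1), card_range] at h1
  exact h1.trans (card_image_le.trans (by simp))

theorem insert (h : PathTree N src R dep par) {a b : ℕ} (ha : a < N)
    (hda : dep a ≠ 0) (hdb : dep b = 0) (hR : 0 < R a b) :
    PathTree N src R (Function.update dep b (dep a + 1)) (Function.update par b a) := by
  have hbs : src ≠ b := by rintro rfl; have := h.root; omega
  have hab : a ≠ b := by rintro rfl; exact hda hdb
  refine ⟨by rw [Function.update_of_ne hbs, h.root], fun c hc hdc => ?_⟩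
  by_cases hcb : c = b
  · subst hcb
    right
    simp only [Function.update_self, Function.update_of_ne hab]
    exact ⟨ha, hda, trivial, hR⟩
  · rw [Function.update_of_ne hcb] at hdc
    refine (h.pred c hc hdc).imp_right fun ⟨h1, h2, h3, h4⟩ => ?_
    have hpb : par c ≠ b := by intro hp; rw [hp] at h2; exact h2 hdb
    simp only [Function.update_of_ne hcb, Function.update_of_ne hpb]
    exact ⟨h1, h2, h3, h4⟩

end PathTree

/-- The invariant of the layered search in phase `r` when the arc from `a` to `b` is to be
examined next. -/
structure LayeredSearch (N src : ℕ) (R : ℕ → ℕ → ℕ) (r a b : ℕ) (dep par : ℕ → ℕ) : Prop where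
  tree : PathTree N src R dep par
  seen : ∀ a' < N, ∀ b' < N, dep a' ≠ 0 → 0 < R a' b' →
    (dep a' ≤ r ∨ (dep a' = r + 1 ∧ (a' < a ∨ (a' = a ∧ b' < b)))) → dep b' ≠ 0

namespace LayeredSearch

variable {N src r a b : ℕ} {R : ℕ → ℕ → ℕ} {dep par : ℕ → ℕ}

/-- The new node has depth `r + 2`, so phase `r` makes no demand on the arcs that leave it. -/
theorem visit (h : LayeredSearch N src R r a b dep par) (ha : a < N)
    (hda : dep a = r + 1) (hdb : dep b = 0) (hR : 0 < R a b) :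
    LayeredSearch N src R r a (b + 1) (Function.update dep b (r + 2)) (Function.update par b a) := by
  refine ⟨?_, fun a' ha' b' hb' => ?_⟩
  · have := h.tree.insert ha (by omega) hdb hR
    rwa [hda] at this
  · intro hda' hR' hc
    by_cases hb : b' = b
    · subst hb; simp
    · rw [Function.update_of_ne hb]
      by_cases hab : a' = b
      · subst hab; simp at hc
      · rw [Function.update_of_ne hab] at hda' hc
        exact h.seen a' ha' b' hb' hda' hR' (by omega)

theorem skip (h : LayeredSearch N src R r a b dep par) (hs : dep b ≠ 0 ∨ R a b = 0) :
    LayeredSearch N src R r a (b + 1) dep par := by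
  refine ⟨h.tree, fun a' ha' b' hb' hda' hR' hc => ?_⟩
  by_cases hab : a' = a ∧ b' = b
  · obtain ⟨rfl, rfl⟩ := hab
    rcases hs with hs | hs
    · exact hs
    · omega
  · exact h.seen a' ha' b' hb' hda' hR' (by omega)

theorem next (h : LayeredSearch N src R r a b dep par) (hs : dep a ≠ r + 1 ∨ N ≤ b) :
    LayeredSearch N src R r (a + 1) 0 dep par := by
  refine ⟨h.tree, fun a' ha' b' hb' hda' hR' hc => ?_⟩
  refine h.seen a' ha' b' hb' hda' hR' ?_
  by_cases haa : a' = a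
  · subst haa; omega
  · omega

theorem next_phase (h : LayeredSearch N src R r N b dep par) :
    LayeredSearch N src R (r + 1) 0 0 dep par :=
  ⟨h.tree, fun a' ha' b' hb' hda' hR' hc => h.seen a' ha' b' hb' hda' hR' (by omega)⟩

/-- After `N` phases every tree node has been processed, because no depth exceeds `N`. -/
theorem closed (h : LayeredSearch N src R N a b dep par) (hs : src < N) :
    ∀ a' < N, ∀ b' < N, dep a' ≠ 0 → 0 < R a' b' → dep b' ≠ 0 :=
  fun a' ha' b' hb' hda' hR' =>
    h.seen a' ha' b' hb' hda' hR' (.inl (h.tree.dep_le hs ha'))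

end LayeredSearch

/-- The invariant of the reversal of the path that leads to `sink`, from its end up to node `x`. -/
structure PathReversal (N src sink : ℕ) (R : ℕ → ℕ → ℕ) (dep : ℕ → ℕ) (i x : ℕ)
    (R' : ℕ → ℕ → ℕ) : Prop where
  lt : x < N
  dep_ne : dep x ≠ 0
  dep_add : x = src ∨ dep x + i ≤ N
  same : ∀ a < N, ∀ b < N, dep a ≤ dep x → dep b ≤ dep x → R' a b = R a b
  cut : ∀ X, sink ∉ X → cut N R' X + (if x ∈ X then 1 else 0) = cut N R X
  sum_le : ∀ a < N, ∀ b < N, R' a b + R' b a ≤ N + 1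

namespace PathReversal

variable {N src sink i x : ℕ} {R R' R'' : ℕ → ℕ → ℕ} {dep par : ℕ → ℕ}

/-- The arc into `x` joins nodes of depth at most `dep x`, between which nothing has changed yet; so
it still has positive capacity and may be reversed. The changes of the cuts telescope along the
path. -/
theorem step (h : PathReversal N src sink R dep i x R') (ht : PathTree N src R dep par)
    (hx : x ≠ src) (h1 : R'' (par x) x = R' (par x) x - 1)
    (h2 : R'' x (par x) = R' x (par x) + 1)
    (hR : ∀ a < N, ∀ b < N, ¬ (a = par x ∧ b = x) → ¬ (a = x ∧ b = par x) → R'' a b = R' a b) :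
    PathReversal N src sink R dep (i + 1) (par x) R'' := by
  obtain ⟨p1, p2, p3, p4⟩ := (ht.pred x h.lt h.dep_ne).resolve_left hx
  have hne : x ≠ par x := by intro he; rw [← he] at p3; omega
  have hpos : 0 < R' (par x) x := by
    rw [h.same _ p1 x h.lt (by omega) le_rfl]; exact p4
  refine ⟨p1, p2, ?_, ?_, ?_, ?_⟩
  · have := h.dep_add; right; omega
  · intro a ha b hb hda hdb
    have hax : a ≠ x := by rintro rfl; omega
    have hbx : b ≠ x := by rintro rfl; omega
    rw [hR a ha b hb (by omega) (by omega), h.same a ha b hb (by omega) (by omega)]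
  · intro X hX
    rw [← h.cut X hX]
    exact cut_reverse h.lt p1 hne hpos (by omega) h2 hR X
  · intro a ha b hb
    have hs := h.sum_le a ha b hb
    by_cases c1 : a = par x ∧ b = x
    · rw [c1.1, c1.2] at hs ⊢; omega
    · by_cases c2 : a = x ∧ b = par x
      · rw [c2.1, c2.2] at hs ⊢; omega
      · rw [hR a ha b hb c1 c2, hR b hb a ha (by omega) (by omega)]; exact hs

theorem par_spec (h : PathReversal N src sink R dep i x R') (ht : PathTree N src R dep par)
    (hx : x ≠ src) : par x < N ∧ x ≠ par x ∧ 0 < R' (par x) x := by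
  obtain ⟨p1, p2, p3, p4⟩ := (ht.pred x h.lt h.dep_ne).resolve_left hx
  refine ⟨p1, ?_, ?_⟩
  · intro he; rw [← he] at p3; omega
  · rw [h.same _ p1 x h.lt (by omega) le_rfl]; exact p4

/-- The program makes a fixed number of passes and idles after reaching the source. -/
theorem stay (h : PathReversal N src sink R dep i src R') :
    PathReversal N src sink R dep (i + 1) src R' :=
  ⟨h.lt, h.dep_ne, .inl rfl, h.same, h.cut, h.sum_le⟩

/-- After `N` passes the source has been reached, since `dep x + N ≤ N` is impossible for a positive
depth. -/
theorem finish (h : PathReversal N src sink R dep N x R') {X : Finset ℕ} (hs : src ∈ X)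
    (hX : sink ∉ X) : TwoClub.cut N R' X + 1 = TwoClub.cut N R X := by
  have hx : x = src := by
    have := h.dep_ne; have := h.dep_add; omega
  have := h.cut X hX
  rwa [hx, if_pos hs] at this

end PathReversal

/-- The invariant of the augmentation of a flow: `flow` is the flow value after `i` rounds, and
`R'` is the residual network. -/
structure Augmentation (N src sink : ℕ) (R : ℕ → ℕ → ℕ) (i flow : ℕ) (R' : ℕ → ℕ → ℕ) : Prop where
  flow_le : flow ≤ i
  cut : ∀ X, src ∈ X → sink ∉ X → cut N R' X + flow = cut N R X
  sum_le : ∀ a < N, ∀ b < N, R' a b + R' b a ≤ N + 1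
  maximal : flow = i ∨ ∃ X, src ∈ X ∧ sink ∉ X ∧ TwoClub.cut N R' X = 0

namespace Augmentation

variable {N src sink i flow : ℕ} {R R' R'' : ℕ → ℕ → ℕ} {dep par : ℕ → ℕ}

theorem augment (h : Augmentation N src sink R i flow R')
    (hc : ∀ X, src ∈ X → sink ∉ X → TwoClub.cut N R'' X + 1 = TwoClub.cut N R' X)
    (hs : ∀ a < N, ∀ b < N, R'' a b + R'' b a ≤ N + 1) :
    Augmentation N src sink R (i + 1) (flow + 1) R'' := by
  have hle := h.flow_le
  refine ⟨by omega, fun X h1 h2 => ?_, hs, ?_⟩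
  · have := h.cut X h1 h2; have := hc X h1 h2; omega
  · rcases h.maximal with h' | ⟨X, h1, h2, h3⟩
    · left; omega
    -- A cut of capacity zero could not have been lowered further.
    · have := hc X h1 h2; omega

/-- The nodes of the tree form the required cut of residual capacity zero: an arc with positive
capacity that leaves a tree node leads to a tree node. -/
theorem stuck (h : Augmentation N src sink R i flow R') (ht : PathTree N src R' dep par)
    (hs : src < N) (hsink : dep sink = 0)
    (hcl : ∀ a < N, ∀ b < N, dep a ≠ 0 → 0 < R' a b → dep b ≠ 0) :
    Augmentation N src sink R (i + 1) flow R' := by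
  refine ⟨h.flow_le.trans (by omega), h.cut, h.sum_le, .inr ?_⟩
  refine ⟨(range N).filter fun a => dep a ≠ 0, ?_, ?_, ?_⟩
  · simp [hs, ht.root]
  · simp [hsink]
  · refine sum_eq_zero fun a ha => sum_eq_zero fun b hb => ?_
    rw [mem_range] at ha hb
    by_contra hne
    simp only [mem_filter, mem_range, not_and, not_not] at hne
    split_ifs at hne with hab
    · exact hcl a ha b hb hab.1.2 (by omega) (hab.2 hb)
    · exact hne rfl

end Augmentation

end TwoClub

/-! ## The minimum cut program -/

namespace WordRAM

open TwoClub

/-- The residual network in array `3`, which has `N` nodes. -/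
def residual (N : ℕ) (s : Store) (a b : ℕ) : ℕ := s.arr 3 (a * N + b)

theorem residual_of_eq {N : ℕ} {s s' : Store} (h : s'.arr 3 = s.arr 3) :
    residual N s' = residual N s := by
  funext a b; simp [residual, h]

theorem residual_setReg {N i x : ℕ} (s : Store) : residual N (s.setReg i x) = residual N s := rfl

theorem residual_setCell {N a b a' b' x : ℕ} (s : Store) (hb : b < N) (hb' : b' < N) :
    residual N (s.setCell 3 (a * N + b) x) a' b' =
      if a' = a ∧ b' = b then x else residual N s a' b' := by
  simp only [residual, Store.setCell_arr, true_and, index_inj hb' hb]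

/-- The index of the arc between the nodes in registers `i` and `j`. -/
def arcExpr (i j : ℕ) : Expr := .op .add (.op .mul (.reg i) (.reg 22)) (.reg j)

theorem arcExpr_small {n B : ℕ} {s : Store} {i j : ℕ} (hB : 16 * (n + 2) ^ 2 ≤ B)
    (hn : s.reg 22 = 2 * n) (hi : s.reg i < 2 * n) (hj : s.reg j < 2 * n) :
    (arcExpr i j).Small B s := by
  have h := index_le (d := s.reg i) (m := 2 * n) (v := s.reg j) hB (by omega) (by omega) (by omega)
  simp only [arcExpr, Expr.Small, Expr.eval, Op.apply, hn, true_and]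
  omega

theorem arcExpr_eval {N : ℕ} {s : Store} {i j : ℕ} (hn : s.reg 22 = N) :
    (arcExpr i j).eval s = s.reg i * N + s.reg j := by
  simp [arcExpr, Expr.eval, Op.apply, hn]

/-- Search for paths that start at the node in register `30`. -/
def pathSearch : Prog :=
  .seq (forLoop 23 22 (.store 4 (.reg 23) (.const 0)))
    (.seq (.store 4 (.reg 30) (.const 1))
      (forLoop 25 22 (forLoop 23 22
        (.cond (.op .eq (.cell 4 (.reg 23)) (.op .add (.reg 25) (.const 1)))
          (forLoop 24 22
            (.cond (.cell 4 (.reg 24)) .skip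
              (.cond (.cell 3 (arcExpr 23 24))
                (.seq (.store 4 (.reg 24) (.op .add (.reg 25) (.const 2)))
                  (.store 5 (.reg 24) (.reg 23)))
                .skip)))
          .skip))))

theorem pathSearch_spec {n src B N : ℕ} {s : Store} (hB : 16 * (n + 2) ^ 2 ≤ B) (hN : 2 * n ≤ N)
    (h22 : s.reg 22 = 2 * n) (h30 : s.reg 30 = src) (hsrc : src < 2 * n) :
    WP B N pathSearch (fun s' => PathTree (2 * n) src (residual (2 * n) s) (s'.arr 4) (s'.arr 5) ∧
      ∀ a < 2 * n, ∀ b < 2 * n, s'.arr 4 a ≠ 0 → 0 < residual (2 * n) s a b → s'.arr 4 b ≠ 0) s := by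
  have hB1 := one_le_of_bound hB
  have hnB : 2 * n + 2 ≤ B := by nlinarith
  -- Only the depths are reset. Old entries of the predecessor array do no harm, as `PathTree`
  -- restricts predecessors only for nodes of nonzero depth other than the source.
  refine .seq (.forLoop (fun j s' => ∀ a < j, s'.arr 4 a = 0) (by omega) (by omega) rfl rfl
    (by omega) (by simp) ?_ ?_)
  · intro j hj s1 hf h23 hI
    refine .store (by omega) (by simp [Expr.Small]) (by simp [Expr.Small]) ?_
    intro a ha
    simp only [Expr.eval, Store.setReg_arr, Store.setCell_arr, h23, true_and]
    split_ifs with h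
    · rfl
    · exact hI a (by omega)
  intro s1 hf1 hI1
  have h122 : s1.reg 22 = 2 * n := (hf1.reg 22 rfl).trans h22
  have h130 : s1.reg 30 = src := (hf1.reg 30 rfl).trans h30
  have h13 : s1.arr 3 = s.arr 3 := hf1.arr 3 rfl
  rw [h22] at hI1
  refine .seq (.store (by omega) (by simp [Expr.Small]) (by simp [Expr.Small]; omega) ?_)
  obtain ⟨s2, hs2⟩ : ∃ s2, s2 = s1.setCell 4 (Expr.eval s1 (.reg 30)) (Expr.eval s1 (.const 1)) :=
    ⟨_, rfl⟩
  rw [← hs2]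
  have h222 : s2.reg 22 = 2 * n := by rw [hs2]; exact h122
  have h23 : s2.arr 3 = s.arr 3 := by rw [hs2, ← h13]; funext m; simp
  have h24 : ∀ a, s2.arr 4 a = if a = src then 1 else s1.arr 4 a := by
    intro a; rw [hs2]; simp [Expr.eval, h130]
  refine .forLoop (fun r s' => LayeredSearch (2 * n) src (residual (2 * n) s) r 0 0
    (s'.arr 4) (s'.arr 5)) (by omega) (by omega) rfl rfl (by omega) ?_ ?_ ?_
  · refine ⟨⟨by simp [h24], fun b hb hd => ?_⟩, fun a ha b hb hd hR hc => ?_⟩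
    · simp only [Store.setReg_arr, h24] at hd
      split_ifs at hd with h
      exacts [.inl h, absurd (hI1 b hb) hd]
    · simp only [Store.setReg_arr, h24] at hd hc
      split_ifs at hd hc with h
      exacts [by omega, absurd (hI1 a ha) hd]
  · intro r hr s3 hf3 h325 hI3
    have h322 : s3.reg 22 = 2 * n := (hf3.reg 22 rfl).trans h222
    refine .forLoop (fun a s' => LayeredSearch (2 * n) src (residual (2 * n) s) r a 0
      (s'.arr 4) (s'.arr 5)) (by omega) (by omega) rfl rfl (by omega) hI3 ?_ ?_
    · intro a ha s4 hf4 h423 hI4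
      have h422 : s4.reg 22 = 2 * n := (hf4.reg 22 rfl).trans h322
      have h425 : s4.reg 25 = r := (hf4.reg 25 rfl).trans h325
      refine .cond (by omega) ?_ (fun hc => ?_) (fun hc => ?_)
      · simp [Expr.Small, Expr.eval, h425]; omega
      · have hda : s4.arr 4 a = r + 1 := by
          by_contra h
          simp [Expr.eval, Op.apply, h423, h425, h] at hc
        -- The body writes to the depths, so the depth of `a` has to be part of the invariant. It
        -- persists because only nodes of depth `0` are overwritten.
        refine .forLoop (fun b s' => LayeredSearch (2 * n) src (residual (2 * n) s) r a b
          (s'.arr 4) (s'.arr 5) ∧ s'.arr 4 a = r + 1) (by omega) (by omega) rfl rfl (by omega)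
          ⟨hI4, hda⟩ ?_ ?_
        · intro b hb s5 hf5 h524 hI5
          have h522 : s5.reg 22 = 2 * n := (hf5.reg 22 rfl).trans h422
          have h525 : s5.reg 25 = r := (hf5.reg 25 rfl).trans h425
          have h523 : s5.reg 23 = a := (hf5.reg 23 rfl).trans h423
          have h53 : s5.arr 3 = s.arr 3 := (hf5.arr 3 rfl).trans
            ((hf4.arr 3 rfl).trans ((hf3.arr 3 rfl).trans h23))
          refine .cond (by omega) (by simp [Expr.Small]) (fun hc => ?_) (fun hc => ?_)
          · simp only [Expr.eval, h524] at hc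
            exact .skip ⟨hI5.1.skip (.inl hc), hI5.2⟩
          · simp only [Expr.eval, h524] at hc
            have hres : Expr.eval s5 (.cell 3 (arcExpr 23 24)) = residual (2 * n) s a b := by
              simp only [Expr.eval, arcExpr_eval h522, h53, h523, h524, residual]
            refine .cond (by omega) ?_ (fun hc' => ?_) (fun hc' => ?_)
            · exact arcExpr_small hB h522 (by omega) (by omega)
            · rw [hres] at hc'
              refine .seq (.store (by omega) (by simp [Expr.Small]) ?_
                (.store (by omega) (by simp [Expr.Small]) (by simp [Expr.Small]) ?_))
              · simp [Expr.Small, Expr.eval, h525]; omega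
              · have hv := hI5.1.visit (by omega) hI5.2 hc (Nat.pos_of_ne_zero hc')
                have e4 : (Function.update (s5.arr 4) b (r + 2)) a = r + 1 := by
                  rw [Function.update_of_ne (by rintro rfl; omega), hI5.2]
                convert And.intro hv e4 using 2
                · funext m
                  simp [Expr.eval, Op.apply, h524, h525, Function.update_apply]
                · funext m
                  simp [Expr.eval, h524, h523, Function.update_apply]
                · simp [Expr.eval, Op.apply, h524, h525, Function.update_apply]
            · rw [hres] at hc'
              exact .skip ⟨hI5.1.skip (.inr hc'), hI5.2⟩
        · intro s5 hf5 hI5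
          exact hI5.1.next (.inr (by omega))
      · refine .skip (hI4.next (.inl fun h => ?_))
        simp [Expr.eval, Op.apply, h423, h425, h] at hc
    · intro s4 hf4 hI4
      rw [h322] at hI4
      exact hI4.next_phase
  · intro s3 hf3 hI3
    rw [h222] at hI3
    exact ⟨hI3.tree, hI3.closed hsrc⟩

/-- Reverse the arcs of the path from the node in register `30` to the node in register `10`. -/
def reversePath : Prog :=
  .seq (.set 28 (.reg 10)) (forLoop 24 22
    (.cond (.op .eq (.reg 28) (.reg 30)) .skip
      (.seq (.set 29 (.cell 5 (.reg 28)))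
        (.seq (.store 3 (arcExpr 29 28) (.op .sub (.cell 3 (arcExpr 29 28)) (.const 1)))
          (.seq (.store 3 (arcExpr 28 29) (.op .add (.cell 3 (arcExpr 28 29)) (.const 1)))
            (.set 28 (.reg 29)))))))

theorem reversePath_spec {n src sink B N : ℕ} {s : Store} (hB : 16 * (n + 2) ^ 2 ≤ B)
    (hN : 2 * n ≤ N) (h22 : s.reg 22 = 2 * n) (h30 : s.reg 30 = src) (h10 : s.reg 10 = sink)
    (hsrc : src < 2 * n) (hsink : sink < 2 * n)
    (ht : PathTree (2 * n) src (residual (2 * n) s) (s.arr 4) (s.arr 5)) (hd : s.arr 4 sink ≠ 0)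
    (hsum : ∀ a < 2 * n, ∀ b < 2 * n,
      residual (2 * n) s a b + residual (2 * n) s b a ≤ 2 * n + 1) :
    WP B N reversePath (fun s' =>
      (∀ X, src ∈ X → sink ∉ X →
        cut (2 * n) (residual (2 * n) s') X + 1 = cut (2 * n) (residual (2 * n) s) X) ∧
      ∀ a < 2 * n, ∀ b < 2 * n,
        residual (2 * n) s' a b + residual (2 * n) s' b a ≤ 2 * n + 1) s := by
  have hB1 := one_le_of_bound hB
  have hnB : 2 * n + 2 ≤ B := by nlinarith
  refine .seq (.set (by omega) (by simp [Expr.Small]) ?_)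
  refine .forLoop (fun i s' => PathReversal (2 * n) src sink (residual (2 * n) s) (s.arr 4) i
    (s'.reg 28) (residual (2 * n) s')) (by omega) (by omega) rfl rfl (by simp; omega) ?_ ?_ ?_
  · have e : ((s.setReg 28 (Expr.eval s (.reg 10))).setReg 24 0).reg 28 = sink := by
      simp [Expr.eval, h10]
    rw [e]
    refine ⟨hsink, hd, .inr (ht.dep_le hsrc hsink), fun _ _ _ _ _ _ => rfl, fun X hX => ?_, hsum⟩
    rw [if_neg hX]; rfl
  · intro i hi s1 hf h24 hI
    have h122 : s1.reg 22 = 2 * n := (hf.reg 22 rfl).trans (by simpa using h22)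
    have h130 : s1.reg 30 = src := (hf.reg 30 rfl).trans (by simpa using h30)
    have h15 : s1.arr 5 = s.arr 5 := hf.arr 5 rfl
    refine .cond (by omega) (by simp [Expr.Small]) (fun hc => ?_) (fun hc => ?_)
    · have hx : s1.reg 28 = src := by
        by_contra h
        simp [Expr.eval, Op.apply, h130, h] at hc
      refine .skip ?_
      rw [hx] at hI
      have e : (s1.setReg 24 (i + 1)).reg 28 = src := by simp [hx]
      rw [e]
      exact hI.stay
    · have hx : s1.reg 28 ≠ src := by
        intro h
        simp [Expr.eval, Op.apply, h130, h] at hc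
      obtain ⟨p1, p2, p3⟩ := hI.par_spec ht hx
      obtain ⟨x, hxe⟩ : ∃ x, x = s1.reg 28 := ⟨_, rfl⟩
      obtain ⟨y, hye⟩ : ∃ y, y = s.arr 5 x := ⟨_, rfl⟩
      rw [← hxe, ← hye] at p1 p2 p3
      have hlt := hI.lt
      -- The bound on the sum of opposite capacities is what keeps the raised arc within a machine
      -- word.
      have hsl := hI.sum_le y p1 x (by omega)
      rw [← hxe] at hlt
      refine .seq (.set (by omega) (by simp [Expr.Small]) ?_)
      obtain ⟨s2, hs2⟩ : ∃ s2, s2 = s1.setReg 29 (Expr.eval s1 (.cell 5 (.reg 28))) := ⟨_, rfl⟩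
      rw [← hs2]
      have h229 : s2.reg 29 = y := by rw [hs2]; simp [Expr.eval, h15, ← hxe, ← hye]
      have h228 : s2.reg 28 = x := by rw [hs2]; simp [← hxe]
      have h222 : s2.reg 22 = 2 * n := by rw [hs2]; simp [h122]
      have r2 : residual (2 * n) s2 = residual (2 * n) s1 := by rw [hs2]; rfl
      refine .seq (.store (by omega) (arcExpr_small hB h222 (by omega) (by omega)) ?_ ?_)
      · exact ⟨arcExpr_small hB h222 (by omega) (by omega), by simp only [Expr.Small]; omega⟩
      obtain ⟨s3, hs3⟩ : ∃ s3, s3 = s2.setCell 3 (Expr.eval s2 (arcExpr 29 28))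
        (Expr.eval s2 (.op .sub (.cell 3 (arcExpr 29 28)) (.const 1))) := ⟨_, rfl⟩
      rw [← hs3]
      have h329 : s3.reg 29 = y := by rw [hs3]; exact h229
      have h328 : s3.reg 28 = x := by rw [hs3]; exact h228
      have h322 : s3.reg 22 = 2 * n := by rw [hs3]; exact h222
      have r3 : ∀ a b, b < 2 * n → residual (2 * n) s3 a b =
          if a = y ∧ b = x then residual (2 * n) s1 y x - 1 else residual (2 * n) s1 a b := by
        intro a b hb
        rw [hs3, arcExpr_eval h222, h229, h228, residual_setCell _ hlt hb, r2, ← r2]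
        simp only [Expr.eval, Op.apply, arcExpr_eval h222, h229, h228, residual]
      refine .seq (.store (by omega) (arcExpr_small hB h322 (by omega) (by omega)) ?_ ?_)
      · refine ⟨arcExpr_small hB h322 (by omega) (by omega), by simp only [Expr.Small]; omega, ?_⟩
        have := r3 x y p1
        rw [if_neg (by omega)] at this
        simp only [Expr.eval, arcExpr_eval h322, h328, h329]
        rw [residual] at this
        rw [this]
        omega
      obtain ⟨s4, hs4⟩ : ∃ s4, s4 = s3.setCell 3 (Expr.eval s3 (arcExpr 28 29))
        (Expr.eval s3 (.op .add (.cell 3 (arcExpr 28 29)) (.const 1))) := ⟨_, rfl⟩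
      rw [← hs4]
      have h429 : s4.reg 29 = y := by rw [hs4]; exact h329
      have r4 : ∀ a b, b < 2 * n → residual (2 * n) s4 a b =
          if a = x ∧ b = y then residual (2 * n) s3 x y + 1 else residual (2 * n) s3 a b := by
        intro a b hb
        rw [hs4, arcExpr_eval h322, h329, h328, residual_setCell _ p1 hb]
        simp only [Expr.eval, Op.apply, arcExpr_eval h322, h329, h328, residual]
      refine .set (by omega) (by simp [Expr.Small]) ?_
      have e : ((s4.setReg 28 (Expr.eval s4 (.reg 29))).setReg 24 (i + 1)).reg 28 = s.arr 5 x := by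
        simp [Expr.eval, h429, hye]
      rw [e, residual_setReg, residual_setReg]
      rw [← hxe] at hI hx
      refine hI.step ht hx ?_ ?_ ?_
      · rw [← hye, r4 y x hlt, if_neg (by omega), r3 y x hlt, if_pos ⟨rfl, rfl⟩]
      · rw [← hye, r4 x y p1, if_pos ⟨rfl, rfl⟩, r3 x y p1, if_neg (by omega)]
      · intro a ha b hb h1 h2
        rw [← hye] at h1 h2
        rw [r4 a b hb, if_neg h2, r3 a b hb, if_neg h1]
  · intro s' hf hI
    have h0 : (s.setReg 28 (Expr.eval s (.reg 10))).reg 22 = 2 * n := by simpa using h22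
    rw [h0] at hI
    exact ⟨fun X h1 h2 => hI.finish h1 h2, hI.sum_le⟩

/-- Augment the flow until the residual network has no path from the node in register `30` to the
node in register `10`. -/
def augmentFlow : Prog :=
  .seq (.set 26 (.const 0)) (forLoop 27 0
    (.seq pathSearch
      (.cond (.cell 4 (.reg 10))
        (.seq reversePath (.set 26 (.op .add (.reg 26) (.const 1))))
        .skip)))

/-- There are always `n` rounds, so at the end either all of them augmented the flow or a residual
cut of capacity zero exists; `flow_lt_iff` rules out the first case whenever it would matter. -/
theorem augmentFlow_spec {n src sink B N : ℕ} {s : Store} (hB : 16 * (n + 2) ^ 2 ≤ B)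
    (hN : 2 * n ≤ N) (h0 : s.reg 0 = n) (h22 : s.reg 22 = 2 * n) (h30 : s.reg 30 = src)
    (h10 : s.reg 10 = sink) (hsrc : src < 2 * n) (hsink : sink < 2 * n)
    (hsum : ∀ a < 2 * n, ∀ b < 2 * n,
      residual (2 * n) s a b + residual (2 * n) s b a ≤ 2 * n + 1) :
    WP B N augmentFlow (fun s' => Augmentation (2 * n) src sink (residual (2 * n) s) n (s'.reg 26)
      (residual (2 * n) s')) s := by
  have hB1 := one_le_of_bound hB
  have hnB : 2 * n + 2 ≤ B := by nlinarith
  refine .seq (.set (by omega) (by simp [Expr.Small]) ?_)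
  refine .forLoop (fun i s' => Augmentation (2 * n) src sink (residual (2 * n) s) i (s'.reg 26)
      (residual (2 * n) s')) (by omega) (by omega) rfl rfl (by simp; omega) ?_ ?_ ?_
  · have e : ((s.setReg 26 (Expr.eval s (.const 0))).setReg 27 0).reg 26 = 0 := by simp [Expr.eval]
    rw [e]
    exact ⟨le_rfl, fun _ _ _ => rfl, hsum, .inl rfl⟩
  · intro i hi s1 hf h27 hI
    replace hi : i < n := by simpa [h0] using hi
    have h122 : s1.reg 22 = 2 * n := (hf.reg 22 rfl).trans (by simpa using h22)
    have h130 : s1.reg 30 = src := (hf.reg 30 rfl).trans (by simpa using h30)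
    have h110 : s1.reg 10 = sink := (hf.reg 10 rfl).trans (by simpa using h10)
    refine .seq ((pathSearch_spec hB hN h122 h130 hsrc).mono fun s2 hf2 h2 => ?_)
    have h222 : s2.reg 22 = 2 * n := (hf2.reg 22 rfl).trans h122
    have h230 : s2.reg 30 = src := (hf2.reg 30 rfl).trans h130
    have h210 : s2.reg 10 = sink := (hf2.reg 10 rfl).trans h110
    have h226 : s2.reg 26 = s1.reg 26 := hf2.reg 26 rfl
    have r2 : residual (2 * n) s2 = residual (2 * n) s1 := residual_of_eq (hf2.arr 3 rfl)
    rw [← r2] at h2 hI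
    rw [← h226] at hI
    refine .cond (by omega) (by simp [Expr.Small]) (fun hc => ?_) (fun hc => ?_)
    · simp only [Expr.eval, h210] at hc
      refine .seq ((reversePath_spec hB hN h222 h230 h210 hsrc hsink h2.1 hc hI.sum_le).mono
        fun s3 hf3 h3 => ?_)
      have h326 : s3.reg 26 = s2.reg 26 := hf3.reg 26 rfl
      have hle := hI.flow_le
      refine .set (by omega) ?_ ?_
      · simp [Expr.Small, Expr.eval, h326]; omega
      · have e : ((s3.setReg 26 (Expr.eval s3 (.op .add (.reg 26) (.const 1)))).setReg 27
            (i + 1)).reg 26 = s2.reg 26 + 1 := by simp [Expr.eval, Op.apply, h326]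
        rw [e]
        exact hI.augment h3.1 h3.2
    · simp only [Expr.eval, h210] at hc
      refine .skip ?_
      have e : (s2.setReg 27 (i + 1)).reg 26 = s2.reg 26 := by simp
      rw [e]
      exact hI.stuck h2.1 hsrc hc h2.2
  · intro s' hf hI
    have e : (s.setReg 26 (Expr.eval s (.const 0))).reg 0 = n := by simpa using h0
    rwa [e] at hI

end WordRAM

/-! ## Connected 2-clubs -/

namespace WordRAM

open TwoClub

open Classical in
/-- The network for the vertex cuts of `G[S]`: every vertex `w` is split into the nodes `w` and
`n + w`, with an arc of capacity one between them if `w` belongs to `S`. -/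
noncomputable def network {n : ℕ} (G : SimpleGraph (Fin n)) (S : Finset (Fin n)) (a b : ℕ) : ℕ :=
  if a < n then if b = n + a ∧ ∃ h : a < n, (⟨a, h⟩ : Fin n) ∈ S then 1 else 0
  else if ∃ (h : a - n < n) (h' : b < n), G.Adj ⟨a - n, h⟩ ⟨b, h'⟩ then n else 0

/-- The vertices in `U` separate `u` and `v` in `G[S]`: the set `Y` consists of the vertices on the
side of `u`. -/
def Separates {n : ℕ} (G : SimpleGraph (Fin n)) (S U Y : Finset (Fin n)) (u v : Fin n) : Prop :=
  u ∉ U ∧ v ∉ U ∧ u ∈ Y ∧ v ∉ Y ∧ ∀ a ∈ Y, ∀ b ∈ S, b ∉ U → G.Adj a b → b ∈ Y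

section Network

variable {n : ℕ} {G : SimpleGraph (Fin n)} {S U Y : Finset (Fin n)} {u v : Fin n}

theorem network_split (w : Fin n) (b : ℕ) :
    network G S w b = if b = n + w ∧ w ∈ S then 1 else 0 := by
  have : (∃ h : (w : ℕ) < n, (⟨w, h⟩ : Fin n) ∈ S) ↔ w ∈ S := by simp
  unfold network
  rw [if_pos w.2]
  simp only [this]

open Classical in
theorem network_edge (w x : Fin n) : network G S (n + w) x = if G.Adj w x then n else 0 := by
  have : (∃ (h : n + (w : ℕ) - n < n) (h' : (x : ℕ) < n), G.Adj ⟨n + w - n, h⟩ ⟨x, h'⟩) ↔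
      G.Adj w x := by simp
  simp only [network, this, if_neg (show ¬ n + (w : ℕ) < n by omega)]

theorem network_out {a b : ℕ} (ha : ¬ a < n) (hb : ¬ b < n) : network G S a b = 0 := by
  simp [network, ha, hb]

theorem network_le (a b : ℕ) (hn : 1 ≤ n) : network G S a b ≤ n := by
  unfold network; split_ifs <;> omega

/-- Let `X` contain the nodes `n + w` for `w ∈ Y` and the nodes `w` for `w ∈ Y`, `w ∈ U` or `w ∉ S`.
Including the complement of `S` keeps edges that lead out of `S` from crossing, so only arcs between
the two nodes of a vertex in `U` leave `X`, with capacity at most one each. -/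
theorem exists_cut_le (hS : v ∈ S) (h : Separates G S U Y u v) :
    ∃ X : Finset ℕ, n + (u : ℕ) ∈ X ∧ (v : ℕ) ∉ X ∧ cut (2 * n) (network G S) X ≤ U.card := by
  classical
  obtain ⟨-, hvU, hu, hv, hY⟩ := h
  obtain ⟨X, hX1, hX2⟩ : ∃ X : Finset ℕ,
      (∀ w : Fin n, (w : ℕ) ∈ X ↔ w ∈ Y ∨ w ∈ U ∨ w ∉ S) ∧
        ∀ w : Fin n, n + (w : ℕ) ∈ X ↔ w ∈ Y := by
    refine ⟨(Finset.range (2 * n)).filter fun a : ℕ =>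
      (∃ w : Fin n, (w ∈ Y ∨ w ∈ U ∨ w ∉ S) ∧ a = (w : ℕ)) ∨ ∃ w ∈ Y, a = n + (w : ℕ),
      fun w => ?_, fun w => ?_⟩ <;> simp only [Finset.mem_filter, Finset.mem_range]
    · constructor
      · rintro ⟨-, ⟨w', h, hw⟩ | ⟨w', h, hw⟩⟩
        · rwa [Fin.ext hw]
        · omega
      · exact fun h => ⟨by omega, .inl ⟨w, h, rfl⟩⟩
    · constructor
      · rintro ⟨-, ⟨w', h, hw⟩ | ⟨w', h, hw⟩⟩
        · omega
        · rwa [Fin.ext (show (w : ℕ) = w' by omega)]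
      · exact fun h => ⟨by omega, .inr ⟨w, h, rfl⟩⟩
  refine ⟨X, (hX2 u).2 hu, fun h => ?_, ?_⟩
  · rcases (hX1 v).1 h with h | h | h
    exacts [hv h, hvU h, h hS]
  have key : ∀ a ∈ Finset.range (2 * n), ∀ b ∈ Finset.range (2 * n),
      (if a ∈ X ∧ b ∉ X then network G S a b else 0) ≤
        if b = n + a then if a ∈ U.map Fin.valEmbedding then 1 else 0 else 0 := by
    intro a ha b hb
    rw [Finset.mem_range] at ha hb
    by_cases hab : a ∈ X ∧ b ∉ X
    swap
    · rw [if_neg hab]; exact Nat.zero_le _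
    rw [if_pos hab]
    by_cases han : a < n
    · obtain ⟨w, rfl⟩ : ∃ w : Fin n, a = w := ⟨⟨a, han⟩, rfl⟩
      rw [network_split]
      by_cases hc : b = n + w ∧ w ∈ S
      · have hwY : w ∉ Y := fun h => hab.2 (by rw [hc.1]; exact (hX2 w).2 h)
        have hwU : w ∈ U := by
          rcases (hX1 w).1 hab.1 with h | h | h
          exacts [absurd h hwY, h, absurd hc.2 h]
        have : (w : ℕ) ∈ U.map Fin.valEmbedding := Finset.mem_map.2 ⟨w, hwU, rfl⟩
        rw [if_pos hc, if_pos hc.1, if_pos this]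
      · rw [if_neg hc]; exact Nat.zero_le _
    · by_cases hbn : b < n
      · obtain ⟨w, rfl⟩ : ∃ w : Fin n, a = n + w := ⟨⟨a - n, by omega⟩, by simp; omega⟩
        obtain ⟨x, rfl⟩ : ∃ x : Fin n, b = x := ⟨⟨b, hbn⟩, rfl⟩
        rw [network_edge, if_neg]
        · exact Nat.zero_le _
        · intro hadj
          refine hab.2 ((hX1 x).2 ?_)
          by_contra hc
          push Not at hc
          exact hc.1 (hY w ((hX2 w).1 hab.1) x hc.2.2 hc.2.1 hadj)
      · rw [network_out han hbn]; exact Nat.zero_le _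
  refine (Finset.sum_le_sum fun a ha => Finset.sum_le_sum (key a ha)).trans ?_
  calc ∑ a ∈ Finset.range (2 * n), ∑ b ∈ Finset.range (2 * n),
        (if b = n + a then if a ∈ U.map Fin.valEmbedding then 1 else 0 else 0)
      ≤ ∑ a ∈ Finset.range (2 * n), if a ∈ U.map Fin.valEmbedding then 1 else 0 := by
        refine Finset.sum_le_sum fun a _ => ?_
        rw [Finset.sum_ite_eq']
        split_ifs <;> simp
    _ ≤ (U.map Fin.valEmbedding).card := by
        rw [Finset.sum_boole]
        exact Finset.card_le_card fun a ha => (Finset.mem_filter.1 ha).2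
    _ = U.card := Finset.card_map _

theorem le_cut {N : ℕ} {R : ℕ → ℕ → ℕ} {X : Finset ℕ} {a b : ℕ} (ha : a < N) (hb : b < N)
    (haX : a ∈ X) (hbX : b ∉ X) : R a b ≤ cut N R X := by
  have h1 := Finset.single_le_sum (f := fun b => if a ∈ X ∧ b ∉ X then R a b else 0)
    (fun _ _ => Nat.zero_le _) (Finset.mem_range.2 hb)
  have h2 := Finset.single_le_sum
    (f := fun a => ∑ b ∈ Finset.range N, if a ∈ X ∧ b ∉ X then R a b else 0)
    (fun _ _ => Nat.zero_le _) (Finset.mem_range.2 ha)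
  simp only [haX, hbX, not_false_eq_true, and_self, if_true, true_and] at h1 h2
  exact h1.trans h2

/-- Edge arcs have capacity `n`, so none of them crosses a cut below `n`, and the vertices of `S`
whose two nodes are split by `X` form the separator. The side of `u` consists of the vertices with
both nodes in `X`; `u` is added separately, as its first node need not lie in `X`. -/
theorem exists_separates {X : Finset ℕ} (hu : n + (u : ℕ) ∈ X) (hv : (v : ℕ) ∉ X) (huv : u ≠ v)
    (hX : cut (2 * n) (network G S) X < n) :
    ∃ U ⊆ S, U.card ≤ cut (2 * n) (network G S) X ∧ ∃ Y, Separates G S U Y u v := by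
  classical
  have hUX : ∀ w : Fin n, w ∈ S.filter (fun w : Fin n => (w : ℕ) ∈ X ∧ n + (w : ℕ) ∉ X) ↔
    w ∈ S ∧ (w : ℕ) ∈ X ∧ n + (w : ℕ) ∉ X := fun w => Finset.mem_filter
  refine ⟨S.filter fun w : Fin n => (w : ℕ) ∈ X ∧ n + (w : ℕ) ∉ X, Finset.filter_subset _ _, ?_,
    insert u (Finset.univ.filter fun w : Fin n => (w : ℕ) ∈ X ∧ n + (w : ℕ) ∈ X), ?_⟩
  · generalize hU : S.filter (fun w : Fin n => (w : ℕ) ∈ X ∧ n + (w : ℕ) ∉ X) = U at hUX ⊢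
    calc U.card = ∑ a ∈ U.map Fin.valEmbedding, 1 := by simp
      _ ≤ ∑ a ∈ U.map Fin.valEmbedding, ∑ b ∈ Finset.range (2 * n),
          (if a ∈ X ∧ b ∉ X then network G S a b else 0) := by
        refine Finset.sum_le_sum fun a ha => ?_
        obtain ⟨w, hw, rfl⟩ := Finset.mem_map.1 ha
        have hw' := (hUX w).1 hw
        have h1 := Finset.single_le_sum
          (f := fun b => if (w : ℕ) ∈ X ∧ b ∉ X then network G S w b else 0)
          (fun _ _ => Nat.zero_le _) (Finset.mem_range.2 (show n + (w : ℕ) < 2 * n by omega))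
        simp only [hw'.2.1, hw'.2.2, not_false_eq_true, and_self, if_true, network_split,
          hw'.1] at h1
        simpa [network_split, hw'.1, hw'.2.1] using h1
      _ ≤ _ := by
        refine Finset.sum_le_sum_of_subset fun a ha => ?_
        obtain ⟨w, hw, rfl⟩ := Finset.mem_map.1 ha
        simp only [Fin.valEmbedding_apply, Finset.mem_range]; omega
  · refine ⟨?_, ?_, Finset.mem_insert_self _ _, ?_, ?_⟩
    · rw [hUX]; exact fun h => h.2.2 hu
    · rw [hUX]; exact fun h => hv h.2.1
    · simp [huv.symm, hv]
    · intro a ha b hb hbU hadj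
      have haX : n + (a : ℕ) ∈ X := by
        rcases Finset.mem_insert.1 ha with rfl | h
        · exact hu
        · exact (Finset.mem_filter.1 h).2.2
      have hbX : (b : ℕ) ∈ X := by
        by_contra hc
        have := le_cut (R := network G S) (show n + (a : ℕ) < 2 * n by omega)
          (show (b : ℕ) < 2 * n by omega) haX hc
        rw [network_edge, if_pos hadj] at this
        omega
      rw [hUX] at hbU
      refine Finset.mem_insert_of_mem (Finset.mem_filter.2 ⟨Finset.mem_univ _, hbX, ?_⟩)
      by_contra hc
      exact hbU ⟨hb, hbX, hc⟩

/-- A maximum flow determines the size of the smallest separators. -/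
theorem flow_lt_iff {flow t : ℕ} {R' : ℕ → ℕ → ℕ}
    (h : Augmentation (2 * n) (n + u) v (network G S) n flow R') (hu : u ∈ S) (hv : v ∈ S)
    (huv : u ≠ v) (hadj : ¬ G.Adj u v) :
    flow < t ↔ ∃ U ⊆ S, U.card < t ∧ ∃ Y, Separates G S U Y u v := by
  classical
  have hle : ∀ U Y, Separates G S U Y u v → flow ≤ U.card := by
    intro U Y hs
    obtain ⟨X, h1, h2, h3⟩ := exists_cut_le hv hs
    have := h.cut X h1 h2
    omega
  constructor
  · intro hft
    have hlt : flow < n := by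
      -- As `u` and `v` are not adjacent, all other vertices of `S` together separate them. So the
      -- flow stays below `n`, and it must have stopped at a residual cut of capacity zero.
      have h1 := hle ((S.erase u).erase v) {u} ⟨by simp, by simp, by simp, by simpa using huv.symm, by
        intro a ha b hb hbU hab
        rw [Finset.mem_singleton] at ha
        subst ha
        simp only [Finset.mem_erase, not_and] at hbU
        rw [Finset.mem_singleton]
        by_contra hba
        by_cases hbv : b = v
        · subst hbv; exact hadj hab
        · exact hbU hbv hba hb⟩
      have h2 : ((S.erase u).erase v).card < S.card :=
        Finset.card_lt_card ((Finset.erase_subset _ _).trans_ssubset (Finset.erase_ssubset hu))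
      have h3 : S.card ≤ n := (Finset.card_le_univ _).trans (by simp)
      omega
    obtain ⟨X, h1, h2, h3⟩ := h.maximal.resolve_left (by omega)
    have h4 := h.cut X h1 h2
    obtain ⟨U, hU, hc, hY⟩ := exists_separates (G := G) (S := S) h1 h2 huv (by omega)
    exact ⟨U, hU, by omega, hY⟩
  · rintro ⟨U, -, hc, Y, hY⟩
    exact (hle U Y hY).trans_lt hc

end Network

/-! ### The test for connected 2-clubs -/

/-- Construct the network for the vertex cuts of `G[S]`. -/
def buildNetwork : Prog :=
  .seq (.set 22 (.op .add (.reg 0) (.reg 0)))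
    (forLoop 23 22 (forLoop 24 22
      (.cond (.op .lt (.reg 23) (.reg 0))
        (.cond (.op .eq (.reg 24) (.op .add (.reg 0) (.reg 23)))
          (.store 3 (arcExpr 23 24) (.cell 2 (.reg 23)))
          (.store 3 (arcExpr 23 24) (.const 0)))
        (.cond (.op .lt (.reg 24) (.reg 0))
          (.store 3 (arcExpr 23 24) (.op .mul (.reg 0)
            (.cell 0 (.op .add (.op .mul (.op .sub (.reg 23) (.reg 0)) (.reg 0)) (.reg 24)))))
          (.store 3 (arcExpr 23 24) (.const 0))))))

theorem buildNetwork_spec {n t B N : ℕ} {G : SimpleGraph (Fin n)} {s : Store} {S : Finset (Fin n)}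
    (hB : 16 * (n + 2) ^ 2 ≤ B) (hN : 2 * n ≤ N) (hE : Enc G t s) (hS : EncSet S s) :
    WP B N buildNetwork (fun s' => s'.reg 22 = 2 * n ∧
      ∀ a < 2 * n, ∀ b < 2 * n, residual (2 * n) s' a b = network G S a b) s := by
  classical
  have hB1 := one_le_of_bound hB
  have hnB : 2 * n + 2 ≤ B := by nlinarith
  have hn := hE.size
  refine .seq (.set (by omega) (by simp [Expr.Small, Expr.eval, hn]; omega) ?_)
  obtain ⟨s0, hs0⟩ : ∃ s0, s0 = s.setReg 22 (Expr.eval s (.op .add (.reg 0) (.reg 0))) := ⟨_, rfl⟩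
  rw [← hs0]
  have h022 : s0.reg 22 = 2 * n := by rw [hs0]; simp [Expr.eval, Op.apply, hn]; omega
  have hE0 : Enc G t s0 := hE.of_eq (by rw [hs0]; simp) (by rw [hs0]; simp) (by rw [hs0]; rfl)
  have hS0 : EncSet S s0 := hS.of_eq (by rw [hs0]; rfl)
  refine .forLoop (fun a s' => ∀ a' < 2 * n, ∀ b' < 2 * n, a' < a →
    residual (2 * n) s' a' b' = network G S a' b') (by omega) (by omega) rfl rfl (by omega)
    (by simp) ?_ ?_
  · intro a ha s1 hf1 h123 hI1
    have h122 : s1.reg 22 = 2 * n := (hf1.reg 22 rfl).trans h022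
    refine .forLoop (fun b s' => ∀ a' < 2 * n, ∀ b' < 2 * n, (a' < a ∨ (a' = a ∧ b' < b)) →
      residual (2 * n) s' a' b' = network G S a' b') (by omega) (by omega) rfl rfl (by omega)
      ?_ ?_ ?_
    · intro a' ha' b' hb' h
      exact hI1 a' ha' b' hb' (by omega)
    · intro b hb s2 hf2 h224 hI2
      have h222 : s2.reg 22 = 2 * n := (hf2.reg 22 rfl).trans h122
      have h223 : s2.reg 23 = a := (hf2.reg 23 rfl).trans h123
      have hE2 : Enc G t s2 := hE0.of_eq ((hf2.reg 0 rfl).trans (hf1.reg 0 rfl))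
        ((hf2.reg 1 rfl).trans (hf1.reg 1 rfl)) ((hf2.arr 0 rfl).trans (hf1.arr 0 rfl))
      have hS2 : EncSet S s2 := hS0.of_eq ((hf2.arr 2 rfl).trans (hf1.arr 2 rfl))
      have h20 := hE2.size
      rw [h022] at ha
      rw [h122] at hb
      -- Shared by the four assignments: storing the right capacity extends the finished part of the
      -- matrix by one entry.
      have put : ∀ e : Expr, e.Small B s2 → e.eval s2 = network G S a b →
          WP B N (.store 3 (arcExpr 23 24) e) (fun s' => ∀ a' < 2 * n, ∀ b' < 2 * n,
            (a' < a ∨ (a' = a ∧ b' < b + 1)) →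
              residual (2 * n) (s'.setReg 24 (b + 1)) a' b' = network G S a' b') s2 := by
        intro e he hev
        refine .store (by omega) (arcExpr_small hB h222 (by omega) (by omega)) he ?_
        intro a' ha' b' hb' h
        rw [residual_setReg, arcExpr_eval h222, h223, h224, residual_setCell _ hb hb']
        split_ifs with hab
        · rw [hab.1, hab.2]; exact hev
        · exact hI2 a' ha' b' hb' (by omega)
      refine .cond (by omega) (by simp [Expr.Small]) (fun hc => ?_) (fun hc => ?_)
      · have han : a < n := by
          by_contra h
          simp [Expr.eval, Op.apply, h223, h20, h] at hc
        have hw := network_split (G := G) (S := S) ⟨a, han⟩ b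
        have hSa := hS2 ⟨a, han⟩
        simp only at hw hSa
        refine .cond (by omega) (by simp [Expr.Small, Expr.eval, h20, h223]; omega)
          (fun hc => put _ (by simp [Expr.Small]) ?_) (fun hc => put _ (by simp [Expr.Small]) ?_)
        · have hbn : b = n + a := by
            by_contra h
            simp [Expr.eval, Op.apply, h223, h224, h20, h] at hc
          rw [hw]
          simp [Expr.eval, h223, hSa, hbn]
        · have hbn : b ≠ n + a := by
            intro h
            simp [Expr.eval, Op.apply, h223, h224, h20, h] at hc
          rw [hw]
          simp [Expr.eval, hbn]
      · have han : ¬ a < n := by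
          intro h
          simp [Expr.eval, Op.apply, h223, h20, h] at hc
        refine .cond (by omega) (by simp [Expr.Small])
          (fun hc => ?_) (fun hc => put _ (by simp [Expr.Small]) ?_)
        · have hbn : b < n := by
            by_contra h
            simp [Expr.eval, Op.apply, h224, h20, h] at hc
          have hw := network_edge (G := G) (S := S) ⟨a - n, by omega⟩ ⟨b, hbn⟩
          have hadj := hE2.adj ⟨a - n, by omega⟩ ⟨b, hbn⟩
          simp only [Nat.add_sub_cancel' (not_lt.1 han)] at hw hadj
          have hi := index_le (d := a - n) (m := n) (v := b) hB (by omega) (by omega) (by omega)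
          refine put _ ?_ ?_
          · simp only [Expr.Small, Expr.eval, Op.apply, h223, h224, h20, true_and, and_true, hadj]
            refine ⟨⟨by omega, by omega⟩, ?_⟩
            split_ifs <;> omega
          · rw [hw]
            simp [Expr.eval, Op.apply, h223, h224, h20, hadj]
        · have hbn : ¬ b < n := by
            intro h
            simp [Expr.eval, Op.apply, h224, h20, h] at hc
          rw [network_out han hbn]
          rfl
    · intro s2 hf2 hI2 a' ha' b' hb' h
      exact hI2 a' ha' b' hb' (by omega)
  · intro s1 hf1 hI1
    rw [h022] at hI1
    exact ⟨(hf1.reg 22 rfl).trans h022, fun a ha b hb => hI1 a ha b hb ha⟩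

/-- The vertices `u` and `v` have distance more than two, or they are separated by fewer than `t`
vertices. -/
def connectedBad : Obstruction := fun _ G t S u v =>
  ¬ G.Adj u v ∧ (common G S u v = 0 ∨ ∃ U ⊆ S, U.card < t ∧ ∃ Y, Separates G S U Y u v)

def connectedTest : Prog :=
  .cond (adjExpr 9 10) (.set 11 (.const 0))
    (.seq countCommon
      (.cond (.reg 21)
        (.seq buildNetwork
          (.seq (.set 30 (.op .add (.reg 0) (.reg 9)))
            (.seq augmentFlow (.set 11 (.op .lt (.reg 26) (.reg 1))))))
        (.set 11 (.const 1))))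

/-- The matrix in memory agrees with `network` only on the nodes of the network, and cuts depend on
nothing else. -/
theorem _root_.TwoClub.Augmentation.congr_network {N src sink i flow : ℕ} {R R₁ R' : ℕ → ℕ → ℕ}
    (h : Augmentation N src sink R i flow R') (hR : ∀ a < N, ∀ b < N, R a b = R₁ a b) :
    Augmentation N src sink R₁ i flow R' :=
  ⟨h.flow_le, fun X h1 h2 => by rw [h.cut X h1 h2, cut_congr hR], h.sum_le, h.maximal⟩

theorem connectedTest_isTest : IsTest connectedBad connectedTest where
  reg := by decide
  arr := by decide
  correct := by
    classical
    intro n G t S B N s u v hB hN hE hS h9 h10 hu hv huv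
    have hB1 := one_le_of_bound hB
    have hnB : 2 * n + 2 ≤ B := by nlinarith
    have ha := adjExpr_eval hE h9 h10
    refine .cond (by omega) (adjExpr_small hB hE.size (by omega) (by omega)) (fun hc => ?_)
      (fun hc => ?_)
    · have hadj : G.Adj u v := by
        by_contra h; simp [ha, h] at hc
      refine .set (by omega) (by simp [Expr.Small]) ?_
      rw [if_neg fun h => h.1 hadj]
      simp [Expr.eval]
    have hadj : ¬ G.Adj u v := by
      intro h; simp [ha, h] at hc
    refine .seq ((countCommon_spec hB hN hE hS h9 h10).mono fun s1 hf1 h121 => ?_)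
    refine .cond (by omega) (by simp [Expr.Small]) (fun hc => ?_) (fun hc => ?_)
    swap
    · simp only [Expr.eval, h121] at hc
      refine .set (by omega) (by simp [Expr.Small]; omega) ?_
      rw [if_pos ⟨hadj, .inl hc⟩]
      simp [Expr.eval]
    simp only [Expr.eval, h121] at hc
    have hE1 : Enc G t s1 := hE.of_eq (hf1.reg 0 rfl) (hf1.reg 1 rfl) (hf1.arr 0 rfl)
    have hS1 : EncSet S s1 := hS.of_eq (hf1.arr 2 rfl)
    refine .seq ((buildNetwork_spec hB hN hE1 hS1).mono fun s2 hf2 h2 => ?_)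
    have h20 : s2.reg 0 = n := (hf2.reg 0 rfl).trans hE1.size
    have h21 : s2.reg 1 = t := (hf2.reg 1 rfl).trans hE1.param
    have h29 : s2.reg 9 = u := (hf2.reg 9 rfl).trans ((hf1.reg 9 rfl).trans h9)
    have h210 : s2.reg 10 = v := (hf2.reg 10 rfl).trans ((hf1.reg 10 rfl).trans h10)
    refine .seq (.set (by omega) (by simp [Expr.Small, Expr.eval, h20, h29]; omega) ?_)
    have hres : ∀ a < 2 * n, ∀ b < 2 * n,
        residual (2 * n) (s2.setReg 30 (Expr.eval s2 (.op .add (.reg 0) (.reg 9)))) a b =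
          network G S a b := h2.2
    refine .seq ((augmentFlow_spec (n := n) (src := n + u) (sink := v) hB hN (by simp [h20])
      (by simp [h2.1]) (by simp [Expr.eval, Op.apply, h20, h29]) (by simp [h210]) (by omega)
      (by omega) ?_).mono fun s3 hf3 h3 => ?_)
    · intro a ha b hb
      rw [hres a ha b hb, hres b hb a ha]
      have hn1 : 1 ≤ n := by omega
      have h1 := network_le (G := G) (S := S) a b hn1
      have h2 := network_le (G := G) (S := S) b a hn1
      omega
    have h31 : s3.reg 1 = t := (hf3.reg 1 rfl).trans (by simpa using h21)
    have hflow := flow_lt_iff (t := t) (h3.congr_network hres) hu hv huv hadj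
    refine .set (by omega) (by simp [Expr.Small]) ?_
    by_cases hlt : s3.reg 26 < t
    · rw [if_pos ⟨hadj, .inr (hflow.1 hlt)⟩]
      simp [Expr.eval, Op.apply, h31, hlt]
    · rw [if_neg fun h => h.2.elim hc fun h' => hlt (hflow.2 h')]
      simp [Expr.eval, Op.apply, h31, hlt]

/-- Common neighbors only disappear in a subset, and a separator restricts to its intersection with
the subset. -/
theorem connectedBad_antitone : Obstruction.Antitone connectedBad := by
  classical
  intro n G t S S' u v h _ _ hb
  refine ⟨hb.1, hb.2.imp (fun h0 => ?_) ?_⟩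
  · have := common_mono G h u v
    omega
  · rintro ⟨U, hU, hc, Y, h1, h2, h3, h4, h5⟩
    refine ⟨U ∩ S', Finset.inter_subset_right,
      (Finset.card_le_card Finset.inter_subset_left).trans_lt hc, Y,
      fun h => h1 (Finset.mem_inter.1 h).1, fun h => h2 (Finset.mem_inter.1 h).1, h3, h4, ?_⟩
    intro a ha b hb hbU hab
    exact h5 a ha b (h hb) (fun hb' => hbU (Finset.mem_inter.2 ⟨hb', hb⟩)) hab

/-- Accept sets of more than `t` and at least `k` vertices. -/
def connectedSizeExpr : Expr :=
  .op .mul (.op .lt (.reg 1) (.reg 13)) sizeExpr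

theorem connectedSizeExpr_isSizeTest :
    IsSizeTest (fun t k m => t < m ∧ k ≤ m) connectedSizeExpr where
  mono _ _ _ _ h h' := ⟨h'.1.trans_le h, h'.2.trans h⟩
  small B s hB := by
    simp only [connectedSizeExpr, sizeExpr, Expr.Small, Expr.eval, Op.apply]
    refine ⟨⟨trivial, trivial⟩, by simpa using hB, ?_⟩
    by_cases h1 : s.reg 1 < s.reg 13 <;> by_cases h2 : s.reg 13 < s.reg 2 <;> simp [h1, h2, hB]
  eval s := by
    have := sizeExpr_isSizeTest.eval s
    by_cases h : s.reg 1 < s.reg 13 <;> simp [connectedSizeExpr, Expr.eval, Op.apply, h, ← this]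

theorem mem_of_walk {V : Type*} {G : SimpleGraph V} {Y : Set V} (h : ∀ a ∈ Y, ∀ b, G.Adj a b → b ∈ Y)
    {u v : V} (p : G.Walk u v) (hu : u ∈ Y) : v ∈ Y := by
  induction p with
  | nil => exact hu
  | cons hadj _ ih => exact ih (h _ hu _ hadj)

/-- A walk in `G[S \ U]` cannot leave a side of a separation; conversely, if `G[S \ U]` has two
vertices that do not reach each other, the vertices reachable from one of them form such a side. -/
theorem isConnected_iff {n : ℕ} {G : SimpleGraph (Fin n)} {t : ℕ} {S : Finset (Fin n)} :
    IsConnected t G S ↔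
      (∀ u ∈ S, ∀ v ∈ S, u ≠ v → ¬ connectedBad n G t S u v) ∧ t < S.card := by
  classical
  constructor
  · rintro ⟨h1, h2, h3⟩
    refine ⟨?_, h2⟩
    rintro u hu v hv huv ⟨hadj, hc | ⟨U, hU, hc, Y, huU, hvU, huY, hvY, hY⟩⟩
    · rw [isTwoClub_iff] at h1
      obtain ⟨w, hw, h4⟩ := h1 u hu v hv huv hadj
      rw [common_eq, Finset.card_eq_zero] at hc
      exact (Finset.eq_empty_iff_forall_notMem.1 hc w) (Finset.mem_filter.2 ⟨hw, h4⟩)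
    · obtain ⟨p⟩ := (h3 U hU hc).preconnected ⟨u, by simp [hu, huU]⟩ ⟨v, by simp [hv, hvU]⟩
      refine hvY (mem_of_walk (Y := Subtype.val ⁻¹' (Y : Set (Fin n))) (fun a ha b hab => ?_) p huY)
      have hb := b.2
      simp only [Set.mem_sdiff, Finset.mem_coe] at hb
      exact hY a.1 ha b.1 hb.1 hb.2 hab
  · rintro ⟨h, ht⟩
    refine ⟨?_, ht, fun U hU hUt => ?_⟩
    · rw [isTwoClub_iff]
      intro u hu v hv huv hadj
      by_contra hc
      push Not at hc
      refine h u hu v hv huv ⟨hadj, .inl ?_⟩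
      rw [common_eq, Finset.card_eq_zero, Finset.eq_empty_iff_forall_notMem]
      intro w hw
      rw [Finset.mem_filter] at hw
      exact hc w hw.1 hw.2.1 hw.2.2
    -- Connectedness includes nonemptiness, which is where `t < S.card` is needed.
    · have hne : (S \ U).Nonempty := by
        rw [← Finset.card_pos, Finset.card_sdiff_of_subset hU]; omega
      obtain ⟨z, hz⟩ := hne
      rw [Finset.mem_sdiff] at hz
      have : Nonempty ((S : Set (Fin n)) \ (U : Set (Fin n)) : Set (Fin n)) :=
        ⟨⟨z, by simpa using hz⟩⟩
      refine ⟨fun x y => ?_⟩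
      by_contra hxy
      have hx := x.2
      have hy := y.2
      simp only [Set.mem_sdiff, Finset.mem_coe] at hx hy
      -- The pair `x, y` is bad, as witnessed by `U` and the component of `x` in `G[S \ U]`.
      refine h x hx.1 y hy.1 (fun he => hxy ?_) ⟨fun hadj => hxy ?_, .inr ⟨U, hU, hUt,
        Finset.univ.filter fun w => ∃ hw, (G.induce _).Reachable x ⟨w, hw⟩, hx.2, hy.2, ?_, ?_, ?_⟩⟩
      · rw [Subtype.ext he]
      · exact SimpleGraph.Adj.reachable (G := G.induce _) hadj
      · exact Finset.mem_filter.2 ⟨Finset.mem_univ _, x.2, .refl _⟩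
      · intro hc
        obtain ⟨_, hw⟩ := (Finset.mem_filter.1 hc).2
        exact hxy hw
      · intro a ha b hb hbU hab
        obtain ⟨ha', hr⟩ := (Finset.mem_filter.1 ha).2
        refine Finset.mem_filter.2 ⟨Finset.mem_univ _, by simp [hb, hbU], hr.trans ?_⟩
        exact SimpleGraph.Adj.reachable (G := G.induce _) hab

theorem connectedTwoClub_solvable : SolvableInTimeO ConnectedTwoClub (fun n => (1.62 : ℝ) ^ n) :=
  solvableInTimeO connectedTest_isTest connectedSizeExpr_isSizeTest connectedBad_antitone
    fun _ _ _ _ => exists_congr fun _ => by rw [isConnected_iff, and_assoc]; rfl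

end WordRAM

theorem mainTheorem6 :
    WordRAM.SolvableInTimeO TwoClub.RobustTwoClub (fun n => (1.62 : ℝ) ^ n) ∧
      WordRAM.SolvableInTimeO TwoClub.HereditaryTwoClub (fun n => (1.62 : ℝ) ^ n) ∧
      WordRAM.SolvableInTimeO TwoClub.ConnectedTwoClub (fun n => (1.62 : ℝ) ^ n) :=
  ⟨WordRAM.robustTwoClub_solvable, WordRAM.hereditaryTwoClub_solvable,
    WordRAM.connectedTwoClub_solvable⟩
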